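/- **Conventions.** Let $R$ be a unital associative ring. Modules are left $R$-modules; right $R$-modules are identified with left $R^{op}$-modules, and for an invariant $\lambda(R)$ defined through left $R$-modules, $\lambda(R^{op})$ denotes the corresponding invariant defined through right $R$-modules. All dimensions and suprema take values in $\{0,1,2,\dots\}\cup\{\infty\}$, and the zero module has dimension $0$. **Definitions.** - A module $M$ is a *PGF-module* (projectively coresolved Gorenstein flat) if it is a syzygy (that is, isomorphic to the image of a differential) of an acyclic complex $P_*=(\cdots\to P_{i+1}\to P_i\to P_{i-1}\to\cdots)$, $i\in\mathbb Z$, of projective modules such that the complex of abelian groups $I\otimes_R P_*$ is acyclic for every injective right $R$-module $I$. - A module $M$ is *Gorenstein projective* if it is a syzygy of an acyclic complex $P_*$ of projective modules such that the complex of abelian groups $\mathrm{Hom}_R(P_*,Q)$ is acyclic for every projective module $Q$. - The *PGF-dimension* $\mathrm{PGF\text{-}dim}_R M$ (resp. the *Gorenstein projective dimension* $\mathrm{Gpd}_R M$) is the least $n\ge 0$ for which there is an exact sequence $0\to G_n\to\cdots\to G_0\to M\to 0$ with all $G_i$ PGF-modules (resp. Gorenstein projective modules), and $\infty$ if there is no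 such $n$. - $\mathrm{PGF\text{-}gl.dim}\,R=\sup_M \mathrm{PGF\text{-}dim}_R M$ and $\mathrm{Ggl.dim}\,R=\sup_M \mathrm{Gpd}_R M$, where $M$ ranges over all left $R$-modules. - $\mathrm{spli}\,R$ is the supremum of the projective dimensions of injective modules, $\mathrm{silp}\,R$ is the supremum of the injective dimensions of projective modules, and $\mathrm{sfli}\,R$ is the supremum of the flat dimensions of injective modules. **Theorem.** For every ring $R$ the following conditions are equivalent: (i) $\mathrm{PGF\text{-}gl.dim}\,R<\infty$; (ii) $\mathrm{PGF\text{-}dim}_R M<\infty$ for every module $M$; (iii) $\mathrm{spli}\,R=\mathrm{silp}\,R<\infty$ and $\mathrm{sfli}\,R=\mathrm{sfli}\,R^{op}<\infty$; (iv) $\mathrm{spli}\,R<\infty$ and $\mathrm{sfli}\,R^{op}<\infty$. If these conditions are satisfied, then $$\mathrm{PGF\text{-}gl.dim}\,R=\mathrm{spli}\,R=\mathrm{silp}\,R=\mathrm{Ggl.dim}\,R.$$ -/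

import Mathlib

open scoped TensorProduct

universe u

noncomputable section

namespace PGF

/-! ### Tensor product over a not necessarily commutative ring

Right `R`-modules are modules over `Rᵐᵒᵖ`; the action `n · r` is `MulOpposite.op r • n`. -/

section Tensor

variable (R : Type u) [Ring R]

/-- The subgroup of `N ⊗[ℤ] M` generated by the elements `(n · r) ⊗ m - n ⊗ (r • m)`. -/
def balancedRel (N M : Type u) [AddCommGroup N] [Module Rᵐᵒᵖ N] [AddCommGroup M] [Module R M] :
    AddSubgroup (N ⊗[ℤ] M) :=
  AddSubgroup.closure {x | ∃ (n : N) (r : R) (m : M),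
    x = (MulOpposite.op r • n) ⊗ₜ[ℤ] m - n ⊗ₜ[ℤ] (r • m)}

/-- The abelian group `N ⊗_R M`, for a right `R`-module `N` and a left `R`-module `M`. -/
abbrev Tensor (N M : Type u) [AddCommGroup N] [Module Rᵐᵒᵖ N] [AddCommGroup M] [Module R M] :
    Type u :=
  (N ⊗[ℤ] M) ⧸ balancedRel R N M

variable {R}

/-- The homomorphism `N ⊗_R f : N ⊗_R M → N ⊗_R M'`, given by `n ⊗ m ↦ n ⊗ f m`. -/
def lTensor (N : Type u) [AddCommGroup N] [Module Rᵐᵒᵖ N]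
    {M M' : Type u} [AddCommGroup M] [Module R M] [AddCommGroup M'] [Module R M']
    (f : M →ₗ[R] M') : Tensor R N M →+ Tensor R N M' :=
  QuotientAddGroup.map (balancedRel R N M) (balancedRel R N M')
    (TensorProduct.map (LinearMap.id : N →ₗ[ℤ] N)
      f.toAddMonoidHom.toIntLinearMap).toAddMonoidHom (by
      refine (AddSubgroup.closure_le _).2 ?_
      rintro _ ⟨n, r, m, rfl⟩
      exact AddSubgroup.subset_closure ⟨n, r, f m, by simp⟩)

/-- The homomorphism `g ⊗_R M : N ⊗_R M → N' ⊗_R M`, given by `n ⊗ m ↦ g n ⊗ m`. -/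
def rTensor {N N' : Type u} [AddCommGroup N] [Module Rᵐᵒᵖ N] [AddCommGroup N'] [Module Rᵐᵒᵖ N']
    (g : N →ₗ[Rᵐᵒᵖ] N') (M : Type u) [AddCommGroup M] [Module R M] :
    Tensor R N M →+ Tensor R N' M :=
  QuotientAddGroup.map (balancedRel R N M) (balancedRel R N' M)
    (TensorProduct.map g.toAddMonoidHom.toIntLinearMap
      (LinearMap.id : M →ₗ[ℤ] M)).toAddMonoidHom (by
      refine (AddSubgroup.closure_le _).2 ?_
      rintro _ ⟨n, r, m, rfl⟩
      exact AddSubgroup.subset_closure ⟨g n, r, m, by simp⟩)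

end Tensor

/-! ### Classes of modules -/

section Classes

variable {R : Type u} [Ring R]

/-- A left `R`-module `M` is flat if `- ⊗_R M` preserves injectivity of homomorphisms of
right `R`-modules. -/
def IsFlat (M : ModuleCat.{u} R) : Prop :=
  ∀ (N N' : ModuleCat.{u} Rᵐᵒᵖ) (g : N →ₗ[Rᵐᵒᵖ] N'),
    Function.Injective g → Function.Injective (rTensor g M)

variable (R) in
/-- An acyclic complex `⋯ → P (i + 1) → P i → P (i - 1) → ⋯` of projective left `R`-modules,
unbounded in both directions. -/
structure AcyclicProjComplex where
  /-- The modules of the complex. -/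
  X : ℤ → ModuleCat.{u} R
  /-- The differentials. -/
  d : ∀ i : ℤ, X (i + 1) →ₗ[R] X i
  projective : ∀ i, Module.Projective R (X i)
  exact : ∀ i, Function.Exact (d (i + 1)) (d i)

/-- `M` is a syzygy of the complex `P`: it is isomorphic to the image of a differential. -/
def AcyclicProjComplex.IsSyzygy (P : AcyclicProjComplex R) (M : ModuleCat.{u} R) : Prop :=
  ∃ i : ℤ, Nonempty (M ≃ₗ[R] LinearMap.range (P.d i))

/-- The complex `I ⊗_R P` is acyclic for any injective right `R`-module `I`. -/
def AcyclicProjComplex.TensorAcyclic (P : AcyclicProjComplex R) : Prop :=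
  ∀ I : ModuleCat.{u} Rᵐᵒᵖ, Module.Injective Rᵐᵒᵖ I →
    ∀ i : ℤ, Function.Exact (lTensor I (P.d (i + 1))) (lTensor I (P.d i))

/-- The complex `Hom_R(P, Q)` is acyclic for any projective left `R`-module `Q`. -/
def AcyclicProjComplex.HomAcyclic (P : AcyclicProjComplex R) : Prop :=
  ∀ Q : ModuleCat.{u} R, Module.Projective R Q →
    ∀ i : ℤ, Function.Exact
      (fun f : P.X i →ₗ[R] Q => f ∘ₗ P.d i)
      (fun f : P.X (i + 1) →ₗ[R] Q => f ∘ₗ P.d (i + 1))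

/-- Projectively coresolved Gorenstein flat modules. -/
def IsPGF (M : ModuleCat.{u} R) : Prop :=
  ∃ P : AcyclicProjComplex R, P.TensorAcyclic ∧ P.IsSyzygy M

/-- Gorenstein projective modules. -/
def IsGorensteinProjective (M : ModuleCat.{u} R) : Prop :=
  ∃ P : AcyclicProjComplex R, P.HomAcyclic ∧ P.IsSyzygy M

/-! ### Dimensions of modules -/

/-- There is an exact sequence `0 → G n → ⋯ → G 0 → M → 0` with `G 0, …, G n` in the class `C`
(continued by zero modules beyond degree `n`). -/
def HasResolution (C : ModuleCat.{u} R → Prop) (M : ModuleCat.{u} R) (n : ℕ) : Prop :=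
  ∃ (G : ℕ → ModuleCat.{u} R) (d : ∀ i : ℕ, G (i + 1) →ₗ[R] G i) (ε : G 0 →ₗ[R] M),
    (∀ i ≤ n, C (G i)) ∧ (∀ i > n, Subsingleton (G i)) ∧
    Function.Surjective ε ∧ Function.Exact (d 0) ε ∧ ∀ i, Function.Exact (d (i + 1)) (d i)

/-- The length of a shortest resolution of `M` by modules of the class `C`; it is `⊤` if there is
no such resolution of finite length. -/
def resolutionDim (C : ModuleCat.{u} R → Prop) (M : ModuleCat.{u} R) : ℕ∞ :=
  sInf {k : ℕ∞ | ∃ n : ℕ, k = n ∧ HasResolution C M n}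

/-- The PGF-dimension of a module. -/
def pgfDim (M : ModuleCat.{u} R) : ℕ∞ := resolutionDim IsPGF M

/-- The Gorenstein projective dimension of a module. -/
def gpd (M : ModuleCat.{u} R) : ℕ∞ := resolutionDim IsGorensteinProjective M

/-- The flat dimension of a module. -/
def fd (M : ModuleCat.{u} R) : ℕ∞ := resolutionDim IsFlat M

/-- The projective dimension of a module, with the convention that the zero module has
dimension `0` (instead of `⊥`). -/
def pd (M : ModuleCat.{u} R) : ℕ∞ := (CategoryTheory.projectiveDimension M).unbotD 0

/-- The injective dimension of a module, with the convention that the zero module has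
dimension `0` (instead of `⊥`). -/
def injd (M : ModuleCat.{u} R) : ℕ∞ := (CategoryTheory.injectiveDimension M).unbotD 0

end Classes

/-! ### Invariants of rings (the corresponding right invariants are those of `Rᵐᵒᵖ`) -/

section Invariants

variable (R : Type u) [Ring R]

/-- The supremum of the projective dimensions of injective left `R`-modules. -/
def spli : ℕ∞ := ⨆ (I : ModuleCat.{u} R) (_ : Module.Injective R I), pd I

/-- The supremum of the injective dimensions of projective left `R`-modules. -/
def silp : ℕ∞ := ⨆ (P : ModuleCat.{u} R) (_ : Module.Projective R P), injd P

/-- The supremum of the flat dimensions of injective left `R`-modules. -/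
def sfli : ℕ∞ := ⨆ (I : ModuleCat.{u} R) (_ : Module.Injective R I), fd I

/-- The left PGF global dimension. -/
def pgfGlDim : ℕ∞ := ⨆ M : ModuleCat.{u} R, pgfDim M

/-- The left Gorenstein global dimension. -/
def gGlDim : ℕ∞ := ⨆ M : ModuleCat.{u} R, gpd M

end Invariants

end PGF

end

/-!
# Rings of finite PGF global dimension

Write `M⋆` for the character module `Hom_ℤ(M, ℚ/ℤ)`.

**PGF-modules are Gorenstein projective.** Let `P` be an acyclic complex of projective modules that
stays acyclic under `J ⊗ -` for all injective right modules `J`, and let `D` be projective. By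
Eilenberg's swindle the terms of `P` may be taken to be free. The right module `D⋆` and its powers
are injective, and exactness of `(D⋆)^K ⊗ P` for all sets `K` is a finiteness condition on `P`
(`LocallyExact`), which passes from `D` to the cokernel of the pure embedding `D → D⋆⋆`. Hence a
cocycle of `Hom(P, D)` extends to a chain map from `P` to the pure coresolution of `D` by double
character modules (`exists_factor_of_locallyExact`). Chain maps from complexes of free modules to
pure acyclic complexes are null-homotopic (`exists_homotopy`): homotopies on subcomplexes with
finitely generated terms are constructed degree by degree, because finitely many relations can be
respected at once, and Zorn's lemma reaches the whole complex. So the cocycle is a coboundary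
(`AcyclicProjComplex.TensorAcyclic.homAcyclic`).

**Upper bounds for injective dimensions.** By the above, PGF-modules have no higher extensions by
projective modules, nor by the modules `J⋆` with `J` an injective right module. Dimension shifting
bounds the injective dimensions of these modules by the PGF global dimension, and direct sums give
a bound even if each PGF-dimension is merely assumed to be finite
(`exists_injd_le_of_pgfDim_lt_top`). The injective dimension of `J⋆` is the flat dimension of `J`
(`fd_le_iff_injd_charModule_le`), so `silp R` and `sfli Rᵐᵒᵖ` are bounded. The groups `Ext(I, J⋆)`,
with `I` and `J` injective, show that `sfli R` and `sfli Rᵐᵒᵖ` agree when both are finite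
(`sfli_eq_sfli_op`).

**Upper bounds for projective dimensions.** A module of finite Gorenstein projective dimension `n`
embeds into a module of projective dimension at most `n` (`exists_isSES_pd_le`); for an injective
module this embedding splits. Hence `spli R ≤ gGlDim R ≤ pgfGlDim R`, and products of injective
modules give `spli R < ⊤` even if each of the dimensions is merely assumed to be finite.

**Complete resolutions.** If `spli R ≤ n`, then the horseshoe lemma, applied to `0 → M → I → M' → 0`
with `I` injective, embeds an `n`-th syzygy of `M` into a projective module, with an `n`-th syzygy
of `M'` as cokernel (`IsNthSyzygy.exists_isSES`). So `n`-th syzygies are syzygies of acyclic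
complexes of projective modules, and if `sfli Rᵐᵒᵖ` is finite, such complexes remain acyclic under
`J ⊗ -`, since `J⋆` has finite injective dimension. Therefore `pgfGlDim R ≤ spli R`.
-/

noncomputable section

namespace PGF

/-! ### Characters and character modules -/

section Characters

/-- The divisible group `ℚ/ℤ`, in which characters take their values. -/
abbrev QZ : Type := AddCircle (1 : ℚ)

section Groups

variable {A B : Type*} [AddCommGroup A] [AddCommGroup B]

/-- A character that vanishes on the kernel of `f` factors through `f`; this is the injectivity
of `ℚ/ℤ`. -/
lemma exists_character_comp_eq (f : A →+ B) (χ : A →+ QZ) (h : ∀ a, f a = 0 → χ a = 0) :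
    ∃ ψ : B →+ QZ, ∀ a, ψ (f a) = χ a := by
  obtain ⟨ψ, hψ⟩ := CharacterModule.dual_surjective_of_injective
    (QuotientAddGroup.kerLift f).toIntLinearMap (QuotientAddGroup.kerLift_injective f)
    (QuotientAddGroup.lift f.ker χ h)
  exact ⟨ψ, fun a => DFunLike.congr_fun hψ (QuotientAddGroup.mk a)⟩

/-- Characters separate the points outside a subgroup from the subgroup. -/
lemma exists_character_ne_zero {H : AddSubgroup A} {a : A} (ha : a ∉ H) :
    ∃ χ : A →+ QZ, (∀ b ∈ H, χ b = 0) ∧ χ a ≠ 0 := by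
  have h : (QuotientAddGroup.mk a : A ⧸ H) ≠ 0 := by
    simpa [QuotientAddGroup.eq_zero_iff] using ha
  obtain ⟨c, hc⟩ := CharacterModule.exists_character_apply_ne_zero_of_ne_zero h
  refine ⟨AddMonoidHom.comp c (QuotientAddGroup.mk' H), fun b hb => ?_, hc⟩
  change c (QuotientAddGroup.mk b) = 0
  rw [(QuotientAddGroup.eq_zero_iff b).2 hb]
  exact map_zero c

lemma eq_zero_of_forall_character {a : A} (h : ∀ χ : A →+ QZ, χ a = 0) : a = 0 :=
  CharacterModule.eq_zero_of_character_apply h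

end Groups

/-- The character group of a right module `N`, regarded as a left module by
`(r • χ) n = χ (n · r)`. -/
def CharL (N : Type u) [AddCommGroup N] : Type u := N →+ QZ

/-- The character group of a left module `M`, regarded as a right module by
`(χ · r) m = χ (r • m)`. -/
def CharR (M : Type u) [AddCommGroup M] : Type u := M →+ QZ

instance (N : Type u) [AddCommGroup N] : AddCommGroup (CharL N) :=
  inferInstanceAs (AddCommGroup (N →+ QZ))

instance (N : Type u) [AddCommGroup N] : FunLike (CharL N) N QZ :=
  inferInstanceAs (FunLike (N →+ QZ) N QZ)

instance (N : Type u) [AddCommGroup N] : AddMonoidHomClass (CharL N) N QZ :=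
  inferInstanceAs (AddMonoidHomClass (N →+ QZ) N QZ)

instance (M : Type u) [AddCommGroup M] : AddCommGroup (CharR M) :=
  inferInstanceAs (AddCommGroup (M →+ QZ))

instance (M : Type u) [AddCommGroup M] : FunLike (CharR M) M QZ :=
  inferInstanceAs (FunLike (M →+ QZ) M QZ)

instance (M : Type u) [AddCommGroup M] : AddMonoidHomClass (CharR M) M QZ :=
  inferInstanceAs (AddMonoidHomClass (M →+ QZ) M QZ)

lemma CharL.ext {N : Type u} [AddCommGroup N] {χ ψ : CharL N} (h : ∀ n, χ n = ψ n) :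
    χ = ψ := DFunLike.ext _ _ h

lemma CharR.ext {M : Type u} [AddCommGroup M] {χ ψ : CharR M} (h : ∀ m, χ m = ψ m) :
    χ = ψ := DFunLike.ext _ _ h

@[simp] lemma CharL.add_apply {N : Type u} [AddCommGroup N] (χ ψ : CharL N) (n : N) :
    (χ + ψ) n = χ n + ψ n := rfl

@[simp] lemma CharR.add_apply {M : Type u} [AddCommGroup M] (χ ψ : CharR M) (m : M) :
    (χ + ψ) m = χ m + ψ m := rfl

@[simp] lemma CharL.zero_apply {N : Type u} [AddCommGroup N] (n : N) : (0 : CharL N) n = 0 := rfl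

variable {R : Type u} [Ring R]

instance (N : Type u) [AddCommGroup N] [Module Rᵐᵒᵖ N] : Module R (CharL N) where
  smul r χ := AddMonoidHom.comp (χ : N →+ QZ) (DistribSMul.toAddMonoidHom N (MulOpposite.op r))
  one_smul χ := CharL.ext fun n => congrArg χ (one_smul Rᵐᵒᵖ n)
  mul_smul r s χ := CharL.ext fun n => congrArg χ (mul_smul (MulOpposite.op s) (MulOpposite.op r) n)
  smul_zero _ := rfl
  smul_add _ _ _ := rfl
  add_smul r s χ := CharL.ext fun n =>
    (congrArg χ (add_smul (MulOpposite.op r) (MulOpposite.op s) n)).trans (map_add χ _ _)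
  zero_smul χ := CharL.ext fun n => (congrArg χ (zero_smul Rᵐᵒᵖ n)).trans (map_zero χ)

instance (M : Type u) [AddCommGroup M] [Module R M] : Module Rᵐᵒᵖ (CharR M) where
  smul r χ := AddMonoidHom.comp (χ : M →+ QZ) (DistribSMul.toAddMonoidHom M r.unop)
  one_smul χ := CharR.ext fun m => congrArg χ (one_smul R m)
  mul_smul r s χ := CharR.ext fun m => congrArg χ (mul_smul s.unop r.unop m)
  smul_zero _ := rfl
  smul_add _ _ _ := rfl
  add_smul r s χ := CharR.ext fun m =>
    (congrArg χ (add_smul r.unop s.unop m)).trans (map_add χ _ _)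
  zero_smul χ := CharR.ext fun m => (congrArg χ (zero_smul R m)).trans (map_zero χ)

@[simp] lemma CharL.smul_apply {N : Type u} [AddCommGroup N] [Module Rᵐᵒᵖ N] (r : R) (χ : CharL N)
    (n : N) : (r • χ) n = χ (MulOpposite.op r • n) := rfl

@[simp] lemma CharR.smul_apply {M : Type u} [AddCommGroup M] [Module R M] (r : Rᵐᵒᵖ) (χ : CharR M)
    (m : M) : (r • χ) m = χ (r.unop • m) := rfl

/-- The restriction of characters along a homomorphism of right modules. -/
def CharL.map {N N' : Type u} [AddCommGroup N] [Module Rᵐᵒᵖ N] [AddCommGroup N'] [Module Rᵐᵒᵖ N']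
    (g : N →ₗ[Rᵐᵒᵖ] N') : CharL N' →ₗ[R] CharL N where
  toFun χ := AddMonoidHom.comp (χ : N' →+ QZ) g.toAddMonoidHom
  map_add' _ _ := rfl
  map_smul' r χ := CharL.ext fun n => (congrArg χ (map_smul g (MulOpposite.op r) n)).symm

lemma CharL.map_surjective {N N' : Type u} [AddCommGroup N] [Module Rᵐᵒᵖ N] [AddCommGroup N']
    [Module Rᵐᵒᵖ N'] {g : N →ₗ[Rᵐᵒᵖ] N'} (hg : Function.Injective g) :
    Function.Surjective (CharL.map g) := fun χ => by
  obtain ⟨ψ, hψ⟩ := exists_character_comp_eq g.toAddMonoidHom (χ : N →+ QZ) fun a ha => by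
    obtain rfl : a = 0 := hg (by simpa using ha)
    exact map_zero χ
  exact ⟨(ψ : CharL N'), CharL.ext hψ⟩

lemma CharL.map_injective {N N' : Type u} [AddCommGroup N] [Module Rᵐᵒᵖ N] [AddCommGroup N']
    [Module Rᵐᵒᵖ N'] {g : N →ₗ[Rᵐᵒᵖ] N'} (hg : Function.Surjective g) :
    Function.Injective (CharL.map g) := fun χ ψ h => CharL.ext fun n => by
  obtain ⟨m, rfl⟩ := hg n
  exact DFunLike.congr_fun h m

lemma CharL.map_exact {N N' N'' : Type u} [AddCommGroup N] [Module Rᵐᵒᵖ N] [AddCommGroup N']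
    [Module Rᵐᵒᵖ N'] [AddCommGroup N''] [Module Rᵐᵒᵖ N''] {f : N →ₗ[Rᵐᵒᵖ] N'}
    {g : N' →ₗ[Rᵐᵒᵖ] N''} (h : Function.Exact f g) :
    Function.Exact (CharL.map g) (CharL.map f) := fun χ => by
  constructor
  · intro hχ
    obtain ⟨ψ, hψ⟩ := exists_character_comp_eq g.toAddMonoidHom (χ : N' →+ QZ) fun a ha => by
      obtain ⟨b, rfl⟩ := (h a).1 ha
      exact DFunLike.congr_fun hχ b
    exact ⟨(ψ : CharL N''), CharL.ext hψ⟩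
  · rintro ⟨ψ, rfl⟩
    refine CharL.ext fun n => ?_
    change ψ (g (f n)) = 0
    rw [(h _).2 ⟨n, rfl⟩]
    exact map_zero ψ

end Characters

/-! ### Characters of tensor products -/

section TensorCharacters

variable {R : Type u} [Ring R]
variable {N N' M M' M'' : Type u} [AddCommGroup N] [Module Rᵐᵒᵖ N] [AddCommGroup N']
  [Module Rᵐᵒᵖ N'] [AddCommGroup M] [Module R M] [AddCommGroup M'] [Module R M']
  [AddCommGroup M''] [Module R M'']

/-- The element `n ⊗ m` of `N ⊗_R M`. -/
def tmul (n : N) (m : M) : Tensor R N M := QuotientAddGroup.mk (n ⊗ₜ[ℤ] m)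

lemma tmul_add (n : N) (m m' : M) :
    (tmul n (m + m') : Tensor R N M) = tmul n m + tmul n m' :=
  congrArg (QuotientAddGroup.mk' (balancedRel R N M)) (TensorProduct.tmul_add n m m')

lemma add_tmul (n n' : N) (m : M) :
    (tmul (n + n') m : Tensor R N M) = tmul n m + tmul n' m :=
  congrArg (QuotientAddGroup.mk' (balancedRel R N M)) (TensorProduct.add_tmul n n' m)

lemma smul_tmul (r : R) (n : N) (m : M) :
    (tmul (MulOpposite.op r • n) m : Tensor R N M) = tmul n (r • m) :=
  QuotientAddGroup.eq_iff_sub_mem.2 (AddSubgroup.subset_closure ⟨n, r, m, rfl⟩)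

@[simp] lemma lTensor_tmul (f : M →ₗ[R] M') (n : N) (m : M) :
    lTensor N f (tmul n m) = tmul n (f m) := rfl

@[simp] lemma rTensor_tmul (g : N →ₗ[Rᵐᵒᵖ] N') (n : N) (m : M) :
    rTensor g M (tmul n m : Tensor R N M) = tmul (g n) m := rfl

lemma tensor_hom_ext {A : Type*} [AddCommGroup A] {φ ψ : Tensor R N M →+ A}
    (h : ∀ n m, φ (tmul n m) = ψ (tmul n m)) : φ = ψ := by
  refine QuotientAddGroup.addMonoidHom_ext _ (AddMonoidHom.ext fun t => ?_)
  induction t using TensorProduct.induction_on with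
  | zero => simp
  | tmul n m => exact h n m
  | add x y hx hy => rw [map_add, map_add, hx, hy]

/-- The character `n ⊗ m ↦ f m n` of `N ⊗_R M` that corresponds to `f : M → N⋆`. -/
def tensorCharacter (f : M →ₗ[R] CharL N) : Tensor R N M →+ QZ :=
  QuotientAddGroup.lift (balancedRel R N M)
    (TensorProduct.liftAddHom
      (AddMonoidHom.mk' (fun n => AddMonoidHom.mk' (fun m => f m n) fun m m' => by
        rw [map_add, CharL.add_apply]) fun n n' => by
          ext m
          exact map_add (f m) n n')
      fun r n m => by
        change f m (r • n) = f (r • m) n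
        rw [map_zsmul, map_zsmul]
        rfl)
    ((AddSubgroup.closure_le _).2 (by
      rintro _ ⟨n, r, m, rfl⟩
      change _ = _
      rw [map_sub, sub_eq_zero]
      change f m (MulOpposite.op r • n) = f (r • m) n
      rw [map_smul f, CharL.smul_apply]))

@[simp] lemma tensorCharacter_tmul (f : M →ₗ[R] CharL N) (n : N) (m : M) :
    tensorCharacter f (tmul n m) = f m n := rfl

/-- The homomorphism `M → N⋆` that corresponds to a character of `N ⊗_R M`. -/
def homOfCharacter (φ : Tensor R N M →+ QZ) : M →ₗ[R] CharL N where
  toFun m := (AddMonoidHom.mk' (fun n => φ (tmul n m)) fun n n' => by rw [add_tmul, map_add] :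
    N →+ QZ)
  map_add' m m' := CharL.ext fun n => by
    change φ (tmul n (m + m')) = φ (tmul n m) + φ (tmul n m')
    rw [tmul_add, map_add]
  map_smul' r m := CharL.ext fun n => congrArg φ (smul_tmul r n m).symm

/-- The homomorphism `M → N⋆` obtained from a homomorphism `N → M⋆`. -/
def homSwap (g : N →ₗ[Rᵐᵒᵖ] CharR M) : M →ₗ[R] CharL N where
  toFun m := (AddMonoidHom.mk' (fun n => g n m) fun n n' => by rw [map_add, CharR.add_apply] :
    N →+ QZ)
  map_add' m m' := CharL.ext fun n => map_add (g n) m m'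
  map_smul' r m := CharL.ext fun n => by
    change g n (r • m) = g (MulOpposite.op r • n) m
    rw [map_smul g, CharR.smul_apply, MulOpposite.unop_op]

/-- The homomorphism `N → M⋆` obtained from a homomorphism `M → N⋆`. -/
def homUnswap (f : M →ₗ[R] CharL N) : N →ₗ[Rᵐᵒᵖ] CharR M where
  toFun n := (AddMonoidHom.mk' (fun m => f m n) fun m m' => by rw [map_add, CharL.add_apply] :
    M →+ QZ)
  map_add' n n' := CharR.ext fun m => map_add (f m) n n'
  map_smul' r n := CharR.ext fun m => by
    change f m (r • n) = f (r.unop • m) n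
    rw [map_smul f, CharL.smul_apply, MulOpposite.op_unop]

/-- `N ⊗_R -` is exact on a sequence if and only if `Hom(-, N⋆)` is. -/
lemma lTensor_exact_iff (f : M →ₗ[R] M') (g : M' →ₗ[R] M'') :
    Function.Exact (lTensor N f) (lTensor N g) ↔
      Function.Exact (fun h : M'' →ₗ[R] CharL N => h ∘ₗ g)
        (fun h : M' →ₗ[R] CharL N => h ∘ₗ f) := by
  constructor
  · intro H h
    constructor
    · intro hf
      obtain ⟨ψ, hψ⟩ := exists_character_comp_eq (lTensor N g) (tensorCharacter h) fun a ha => by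
        obtain ⟨b, rfl⟩ := (H a).1 ha
        have : (tensorCharacter h).comp (lTensor N f) = 0 := tensor_hom_ext fun n m =>
          DFunLike.congr_fun (DFunLike.congr_fun hf m) n
        exact DFunLike.congr_fun this b
      refine ⟨homOfCharacter ψ, LinearMap.ext fun m => CharL.ext fun n => ?_⟩
      exact hψ (tmul n m)
    · rintro ⟨k, rfl⟩
      refine LinearMap.ext fun m => CharL.ext fun n => ?_
      have h1 : lTensor N g (lTensor N f (tmul n m)) = 0 := (H _).2 ⟨_, rfl⟩
      exact (congrArg (tensorCharacter k) h1).trans (map_zero _)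
  · intro H t
    constructor
    · intro ht
      by_contra hcon
      obtain ⟨χ, hχ, hne⟩ := exists_character_ne_zero (H := (lTensor N f).range) hcon
      obtain ⟨k, hk⟩ := (H (homOfCharacter χ)).1 (LinearMap.ext fun m => CharL.ext fun n =>
        hχ _ ⟨tmul n m, rfl⟩)
      have : χ = (tensorCharacter k).comp (lTensor N g) := tensor_hom_ext fun n m =>
        (DFunLike.congr_fun (DFunLike.congr_fun hk m) n).symm
      apply hne
      rw [this, AddMonoidHom.comp_apply, ht, map_zero]
    · rintro ⟨s, rfl⟩
      refine eq_zero_of_forall_character fun χ => ?_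
      have h0 := (H (homOfCharacter χ ∘ₗ g)).2 ⟨_, rfl⟩
      have : (χ.comp (lTensor N g)).comp (lTensor N f) = 0 := tensor_hom_ext fun n m =>
        DFunLike.congr_fun (DFunLike.congr_fun h0 m) n
      exact DFunLike.congr_fun this s

/-- `g ⊗_R M` is injective if and only if all homomorphisms `M → N⋆` lift along `g⋆`. -/
lemma rTensor_injective_iff (g : N →ₗ[Rᵐᵒᵖ] N') :
    Function.Injective (rTensor g M : Tensor R N M →+ Tensor R N' M) ↔
      ∀ f : M →ₗ[R] CharL N, ∃ f' : M →ₗ[R] CharL N', CharL.map g ∘ₗ f' = f := by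
  constructor
  · intro H f
    obtain ⟨ψ, hψ⟩ := exists_character_comp_eq (rTensor g M) (tensorCharacter f) fun a ha => by
      rw [(injective_iff_map_eq_zero _).1 H a ha, map_zero]
    exact ⟨homOfCharacter ψ, LinearMap.ext fun m => CharL.ext fun n => hψ (tmul n m)⟩
  · intro H
    refine (injective_iff_map_eq_zero _).2 fun t ht => eq_zero_of_forall_character fun χ => ?_
    obtain ⟨f', hf'⟩ := H (homOfCharacter χ)
    have : χ = (tensorCharacter f').comp (rTensor g M) := tensor_hom_ext fun n m =>
      (DFunLike.congr_fun (DFunLike.congr_fun hf' m) n).symm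
    rw [this, AddMonoidHom.comp_apply, ht, map_zero]

end TensorCharacters

/-! ### Flat modules and their character modules -/

section Flat

lemma isFlat_of_projective {R : Type u} [Ring R] (M : ModuleCat.{u} R) [Module.Projective R M] :
    IsFlat M := fun _ _ g hg =>
  (rTensor_injective_iff g).2 fun f =>
    Module.projective_lifting_property (CharL.map g) f (CharL.map_surjective hg)

/-- The character module of a flat left module is an injective right module. -/
lemma IsFlat.injective_charR {R : Type u} [Ring R] {M : ModuleCat.{u} R} (hM : IsFlat M) :
    Module.Injective Rᵐᵒᵖ (CharR M) := ⟨fun X Y _ _ _ _ f hf g => by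
  obtain ⟨h, hh⟩ := (rTensor_injective_iff (M := M) f).1
    (hM (ModuleCat.of _ X) (ModuleCat.of _ Y) f hf) (homSwap g)
  exact ⟨homUnswap h, fun x => CharR.ext fun m => DFunLike.congr_fun (DFunLike.congr_fun hh m) x⟩⟩

/-- A right module is flat, as a left module over the opposite ring, if and only if its character
module is an injective left module. -/
lemma isFlat_op_iff {R : Type u} [Ring R] (J : ModuleCat.{u} Rᵐᵒᵖ) :
    IsFlat J ↔ Module.Injective R (CharL J) := by
  constructor
  · intro hJ
    refine ⟨fun X Y _ _ _ _ f hf g => ?_⟩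
    let : Module Rᵐᵒᵖᵐᵒᵖ X := Module.compHom X (RingEquiv.opOp R).symm.toRingHom
    let : Module Rᵐᵒᵖᵐᵒᵖ Y := Module.compHom Y (RingEquiv.opOp R).symm.toRingHom
    let f' : X →ₗ[Rᵐᵒᵖᵐᵒᵖ] Y :=
      { toFun := f, map_add' := map_add f, map_smul' := fun r x => map_smul f r.unop.unop x }
    let g' : X →ₗ[Rᵐᵒᵖᵐᵒᵖ] CharR J :=
      { toFun := fun x => (g x : J →+ QZ)
        map_add' := map_add g
        map_smul' := fun r x => map_smul g r.unop.unop x }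
    obtain ⟨h, hh⟩ := (rTensor_injective_iff (R := Rᵐᵒᵖ) (M := J) f').1
      (hJ (ModuleCat.of _ X) (ModuleCat.of _ Y) f' hf) (homSwap g')
    let h' : Y →ₗ[R] CharL J :=
      { toFun := fun y => (homUnswap h y : J →+ QZ)
        map_add' := map_add (homUnswap h)
        map_smul' := fun r y => map_smul (homUnswap h) (MulOpposite.op (MulOpposite.op r)) y }
    exact ⟨h', fun x => CharL.ext fun j => DFunLike.congr_fun (DFunLike.congr_fun hh j) x⟩
  · intro hJ N N' g hg
    refine (rTensor_injective_iff (R := Rᵐᵒᵖ) g).2 fun f => ?_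
    let : Module R N := Module.compHom N (RingEquiv.opOp R).toRingHom
    let : Module R N' := Module.compHom N' (RingEquiv.opOp R).toRingHom
    let g' : N →ₗ[R] N' :=
      { toFun := g, map_add' := map_add g, map_smul' := fun r x => map_smul g
          (MulOpposite.op (MulOpposite.op r)) x }
    let f' : N →ₗ[R] CharL J :=
      { toFun := fun x => (homUnswap f x : J →+ QZ)
        map_add' := map_add (homUnswap f)
        map_smul' := fun r x => map_smul (homUnswap f) (MulOpposite.op (MulOpposite.op r)) x }
    obtain ⟨h, hh⟩ := hJ.out g' hg f'
    let h' : N' →ₗ[Rᵐᵒᵖᵐᵒᵖ] CharR J :=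
      { toFun := fun y => (h y : J →+ QZ)
        map_add' := map_add h
        map_smul' := fun r y => map_smul h r.unop.unop y }
    exact ⟨homSwap h', LinearMap.ext fun j => CharL.ext fun n => DFunLike.congr_fun (hh n) j⟩

end Flat

/-! ### Tensor products with free modules -/

section TensorFree

variable {R : Type u} [Ring R] {B : Type u} {N N' : Type u} [AddCommGroup N] [Module Rᵐᵒᵖ N]
  [AddCommGroup N'] [Module Rᵐᵒᵖ N']

/-- The additive map `n ↦ n ⊗ m`. -/
def tmulHom (R : Type u) [Ring R] (N : Type u) [AddCommGroup N] [Module Rᵐᵒᵖ N]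
    {M : Type u} [AddCommGroup M] [Module R M] (m : M) : N →+ Tensor R N M :=
  AddMonoidHom.mk' (fun n => tmul n m) fun n n' => add_tmul n n' m

@[simp] lemma tmulHom_apply {M : Type u} [AddCommGroup M] [Module R M] (m : M) (n : N) :
    tmulHom R N m n = tmul n m := rfl

@[simp] lemma zero_tmul {M : Type u} [AddCommGroup M] [Module R M] (m : M) :
    (tmul (0 : N) m : Tensor R N M) = 0 := map_zero (tmulHom R N m)

/-- The coordinate at `b` of an element of `N ⊗_R R^(B)`. -/
def tensorCoord (b : B) : Tensor R N (B →₀ R) →+ N :=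
  QuotientAddGroup.lift (balancedRel R N (B →₀ R))
    (TensorProduct.liftAddHom
      (AddMonoidHom.mk' (fun n => AddMonoidHom.mk' (fun p : B →₀ R => MulOpposite.op (p b) • n)
        fun p q => by simp [add_smul]) fun n n' => by
          ext p
          simp)
      fun r n p => by
        change MulOpposite.op (p b) • r • n = MulOpposite.op ((r • p) b) • n
        rw [Finsupp.smul_apply, MulOpposite.op_smul, smul_assoc, smul_comm])
    ((AddSubgroup.closure_le _).2 (by
      rintro _ ⟨n, r, p, rfl⟩
      change _ = _
      rw [map_sub, sub_eq_zero]
      change MulOpposite.op (p b) • MulOpposite.op r • n = MulOpposite.op ((r • p) b) • n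
      rw [Finsupp.smul_apply, smul_eq_mul, MulOpposite.op_mul, mul_smul]))

@[simp] lemma tensorCoord_tmul (b : B) (n : N) (p : B →₀ R) :
    tensorCoord b (tmul n p : Tensor R N (B →₀ R)) = MulOpposite.op (p b) • n := rfl

lemma tensorCoord_rTensor (b : B) (g : N →ₗ[Rᵐᵒᵖ] N') (t : Tensor R N (B →₀ R)) :
    tensorCoord b (rTensor g _ t) = g (tensorCoord b t) := by
  have : (tensorCoord b).comp (rTensor g (B →₀ R)) = g.toAddMonoidHom.comp (tensorCoord b) :=
    tensor_hom_ext fun n p => (map_smul g _ n).symm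
  exact DFunLike.congr_fun this t

lemma exists_eq_sum_tmul_single (t : Tensor R N (B →₀ R)) :
    ∃ x : B →₀ N, t = ∑ b ∈ x.support, tmul (x b) (Finsupp.single b 1) := by
  suffices h : ∃ x : B →₀ N, t = x.sum fun b n => tmulHom R N (Finsupp.single b (1 : R)) n from h
  obtain ⟨t, rfl⟩ := QuotientAddGroup.mk_surjective t
  induction t using TensorProduct.induction_on with
  | zero => exact ⟨0, by simp⟩
  | tmul n p =>
    induction p using Finsupp.induction_linear with
    | zero => exact ⟨0, by simp⟩
    | add p q hp hq =>
      obtain ⟨x, hx⟩ := hp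
      obtain ⟨y, hy⟩ := hq
      refine ⟨x + y, ?_⟩
      rw [Finsupp.sum_add_index' (fun _ => map_zero _) (fun _ => map_add _), ← hx, ← hy]
      exact tmul_add n p q
    | single b r =>
      refine ⟨Finsupp.single b (MulOpposite.op r • n), ?_⟩
      rw [Finsupp.sum_single_index
        (h := fun b n => tmulHom R N (Finsupp.single b (1 : R)) n) (map_zero _),
        tmulHom_apply, smul_tmul]
      simp [tmul]
  | add s t hs ht =>
    obtain ⟨x, hx⟩ := hs
    obtain ⟨y, hy⟩ := ht
    refine ⟨x + y, ?_⟩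
    rw [Finsupp.sum_add_index' (fun _ => map_zero _) (fun _ => map_add _), ← hx, ← hy]
    rfl

lemma tensor_eq_zero_of_coord {t : Tensor R N (B →₀ R)} (h : ∀ b, tensorCoord b t = 0) :
    t = 0 := by
  classical
  obtain ⟨x, rfl⟩ := exists_eq_sum_tmul_single t
  refine Finset.sum_eq_zero fun b hb => ?_
  have := h b
  rw [map_sum, Finset.sum_eq_single_of_mem b hb] at this
  · have h0 : x b = 0 := by simpa using this
    rw [h0, zero_tmul]
  · intro c _ hc
    simp [Finsupp.single_eq_of_ne' hc]

end TensorFree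

/-! ### A finiteness condition on extending homomorphisms -/

section LocalConditions

variable {R : Type u} [Ring R] {A B C : Type u}

/-- The evaluation homomorphism `D → D⋆⋆`. -/
def bidualMap (R : Type u) [Ring R] (D : Type u) [AddCommGroup D] [Module R D] :
    D →ₗ[R] CharL (CharR D) :=
  homSwap LinearMap.id

lemma bidualMap_injective (D : Type u) [AddCommGroup D] [Module R D] :
    Function.Injective (bidualMap R D) :=
  (injective_iff_map_eq_zero _).2 fun _ hx =>
    eq_zero_of_forall_character fun χ => DFunLike.congr_fun hx (χ : CharR D)

/-- Given homomorphisms `d' : R^(A) → R^(B)` and `d : R^(B) → R^(C)`, the module `D` is locally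
extending if for any finite set `S` of basis elements in the middle there is a finite set `T` of
basis elements on the left, such that any homomorphism `χ` to `D` with `χ ∘ d' = 0` on `T` factors
through `d` on `S`. The point is that `T` does not depend on `χ`. -/
def LocallyExtending (d' : (A →₀ R) →ₗ[R] (B →₀ R)) (d : (B →₀ R) →ₗ[R] (C →₀ R))
    (D : Type u) [AddCommGroup D] [Module R D] : Prop :=
  ∀ S : Finset B, ∃ T : Finset A, ∀ χ : (B →₀ R) →ₗ[R] D,
    (∀ a ∈ T, χ (d' (Finsupp.single a 1)) = 0) →
      ∃ θ : (C →₀ R) →ₗ[R] D, ∀ b ∈ S, χ (Finsupp.single b 1) = θ (d (Finsupp.single b 1))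

/-- Given homomorphisms `d' : R^(A) → R^(B)` and `d : R^(B) → R^(C)`, the right module `E` is
locally exact if any cycle of `E ⊗ R^(B)` with support in a finite set `S` is the boundary of an
element with support in a finite set `T`, which depends on `S` only. -/
def LocallyExact (d' : (A →₀ R) →ₗ[R] (B →₀ R)) (d : (B →₀ R) →ₗ[R] (C →₀ R))
    (E : Type u) [AddCommGroup E] [Module Rᵐᵒᵖ E] : Prop :=
  ∀ S : Finset B, ∃ T : Finset A, ∀ x : B → E,
    ∑ b ∈ S, (tmul (x b) (d (Finsupp.single b 1)) : Tensor R E (C →₀ R)) = 0 →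
      ∃ y : A → E, ∑ a ∈ T, (tmul (y a) (d' (Finsupp.single a 1)) : Tensor R E (B →₀ R)) =
        ∑ b ∈ S, tmul (x b) (Finsupp.single b 1)

variable {d' : (A →₀ R) →ₗ[R] (B →₀ R)} {d : (B →₀ R) →ₗ[R] (C →₀ R)}

/-- If `J^K ⊗ -` is exact for all sets `K`, then `J` is locally exact: exactness is applied to the
universal cycle with support in `S`, for which `K` is the set of all such cycles. -/
lemma locallyExact_of_forall_pi {J : Type u} [AddCommGroup J] [Module Rᵐᵒᵖ J]
    (h : ∀ K : Type u, Function.Exact (lTensor (K → J) d') (lTensor (K → J) d)) :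
    LocallyExact d' d J := by
  intro S
  let K := {x : B → J //
    ∑ b ∈ S, (tmul (x b) (d (Finsupp.single b 1)) : Tensor R J (C →₀ R)) = 0}
  let t : Tensor R (K → J) (B →₀ R) := ∑ b ∈ S, tmul (fun k : K => k.1 b) (Finsupp.single b 1)
  have ht : lTensor (K → J) d t = 0 := by
    refine tensor_eq_zero_of_coord fun c => funext fun k => ?_
    have := tensorCoord_rTensor c (LinearMap.proj (R := Rᵐᵒᵖ) (φ := fun _ : K => J) k)
      (lTensor (K → J) d t)
    rw [LinearMap.proj_apply] at this
    rw [← this]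
    simp only [t, map_sum, lTensor_tmul, rTensor_tmul, LinearMap.proj_apply]
    rw [← map_sum, k.2, map_zero]
    rfl
  obtain ⟨w, hw⟩ := (h K t).1 ht
  obtain ⟨z, rfl⟩ := exists_eq_sum_tmul_single w
  refine ⟨z.support, fun x hx => ⟨fun a => z a ⟨x, hx⟩, ?_⟩⟩
  have := congrArg (rTensor (LinearMap.proj (R := Rᵐᵒᵖ) (φ := fun _ : K => J) ⟨x, hx⟩) (B →₀ R)) hw
  simpa only [t, map_sum, lTensor_tmul, rTensor_tmul, LinearMap.proj_apply] using this

lemma LocallyExact.exact {E : Type u} [AddCommGroup E] [Module Rᵐᵒᵖ E]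
    (h : LocallyExact d' d E) (hd : d ∘ₗ d' = 0) :
    Function.Exact (lTensor E d') (lTensor E d) := by
  intro t
  constructor
  · intro ht
    obtain ⟨x, rfl⟩ := exists_eq_sum_tmul_single t
    obtain ⟨T, hT⟩ := h x.support
    obtain ⟨y, hy⟩ := hT x (by simpa only [map_sum, lTensor_tmul] using ht)
    refine ⟨∑ a ∈ T, tmul (y a) (Finsupp.single a 1), ?_⟩
    simpa only [map_sum, lTensor_tmul] using hy
  · rintro ⟨s, rfl⟩
    have : (lTensor E d).comp (lTensor E d') = 0 := tensor_hom_ext fun n p => by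
      have h0 : d (d' p) = 0 := LinearMap.congr_fun hd p
      rw [AddMonoidHom.comp_apply, lTensor_tmul, lTensor_tmul, h0]
      refine tensor_eq_zero_of_coord fun c => ?_
      simp
    exact DFunLike.congr_fun this s

lemma LocallyExact.locallyExtending {E : Type u} [AddCommGroup E] [Module Rᵐᵒᵖ E]
    (h : LocallyExact d' d E) : LocallyExtending d' d (CharL E) := by
  classical
  intro S
  obtain ⟨T, hT⟩ := h S
  refine ⟨T, fun χ hχ => ?_⟩
  let φ : (B → E) →+ Tensor R E (B →₀ R) :=
    ∑ b ∈ S, (tmulHom R E (Finsupp.single b (1 : R))).comp (Pi.evalAddMonoidHom (fun _ => E) b)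
  have hφ : ∀ x, φ x = ∑ b ∈ S, tmul (x b) (Finsupp.single b 1) := fun x => by
    simp only [φ, AddMonoidHom.finsetSum_apply]
    rfl
  obtain ⟨ψ, hψ⟩ := exists_character_comp_eq ((lTensor E d).comp φ) ((tensorCharacter χ).comp φ)
    fun x hx => by
      obtain ⟨y, hy⟩ := hT x (by
        simpa only [AddMonoidHom.comp_apply, hφ, map_sum, lTensor_tmul] using hx)
      rw [AddMonoidHom.comp_apply, hφ, ← hy, map_sum]
      refine Finset.sum_eq_zero fun a ha => ?_
      rw [tensorCharacter_tmul, hχ a ha, CharL.zero_apply]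
  refine ⟨homOfCharacter ψ, fun b hb => CharL.ext fun e => ?_⟩
  have h1 : φ (Pi.single b e) = tmul e (Finsupp.single b 1) := by
    rw [hφ, Finset.sum_eq_single_of_mem b hb, Pi.single_eq_same]
    intro c _ hc
    rw [Pi.single_eq_of_ne hc, zero_tmul]
  have := hψ (Pi.single b e)
  simp only [AddMonoidHom.comp_apply, h1, tensorCharacter_tmul, lTensor_tmul] at this
  exact this.symm

/-- Elements of `D⋆ ⊗ R^(B)` are separated by the homomorphisms `R^(B) → D`. -/
lemma tensor_charR_eq_zero {D : Type u} [AddCommGroup D] [Module R D]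
    {t : Tensor R (CharR D) (B →₀ R)}
    (h : ∀ χ : (B →₀ R) →ₗ[R] D, tensorCharacter (bidualMap R D ∘ₗ χ) t = 0) : t = 0 := by
  refine tensor_eq_zero_of_coord fun b => CharR.ext fun m => ?_
  let χ : (B →₀ R) →ₗ[R] D := (LinearMap.toSpanSingleton R D m) ∘ₗ Finsupp.lapply b
  have : tensorCharacter (bidualMap R D ∘ₗ χ) =
      (AddMonoidHom.mk' (fun c : CharR D => c m) fun c c' => rfl).comp (tensorCoord b) :=
    tensor_hom_ext fun c p => rfl
  have h1 := h χ
  rw [this] at h1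
  exact h1

lemma LocallyExtending.locallyExact {D : Type u} [AddCommGroup D] [Module R D]
    (h : LocallyExtending d' d D) : LocallyExact d' d (CharR D) := by
  classical
  intro S
  obtain ⟨T, hT⟩ := h S
  refine ⟨T, fun x hx => ?_⟩
  let ρ : ((B →₀ R) →ₗ[R] D) →+ (A → D) :=
    AddMonoidHom.mk' (fun χ a => if a ∈ T then χ (d' (Finsupp.single a 1)) else 0) fun χ χ' => by
      ext a
      by_cases ha : a ∈ T <;> simp [ha]
  let ξ : ((B →₀ R) →ₗ[R] D) →+ QZ :=
    AddMonoidHom.mk' (fun χ => ∑ b ∈ S, x b (χ (Finsupp.single b 1))) fun χ χ' => by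
      simp [Finset.sum_add_distrib]
  obtain ⟨v, hv⟩ := exists_character_comp_eq ρ ξ fun χ hχ => by
    obtain ⟨θ, hθ⟩ := hT χ fun a ha => by simpa [ρ, ha] using congrFun hχ a
    have h1 := congrArg (tensorCharacter (bidualMap R D ∘ₗ θ)) hx
    rw [map_sum, map_zero] at h1
    refine (Finset.sum_congr rfl fun b hb => ?_).trans h1
    rw [hθ b hb]
    rfl
  refine ⟨fun a => v.comp (AddMonoidHom.single (fun _ : A => D) a), ?_⟩
  rw [← sub_eq_zero]
  refine tensor_charR_eq_zero fun χ => ?_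
  rw [map_sub, sub_eq_zero, map_sum, map_sum]
  refine Eq.trans ?_ (hv χ)
  have : ρ χ = ∑ a ∈ T, Pi.single a (χ (d' (Finsupp.single a 1))) := by
    ext a
    simp [ρ, Finset.sum_apply, Pi.single_apply]
  rw [this, map_sum]
  rfl

end LocalConditions

/-! ### Pure epimorphisms -/

section Purity

variable {R : Type u} [Ring R]

/-- A sequence `X → Y → Z` is pure exact at `Y` if it is a complex and homomorphisms from free
modules to the kernel of `Y → Z` that satisfy finitely many relations can be lifted to `X` so that
the relations are preserved. -/
structure PureExact {X Y Z : Type u} [AddCommGroup X] [Module R X] [AddCommGroup Y] [Module R Y]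
    [AddCommGroup Z] [Module R Z] (f : X →ₗ[R] Y) (g : Y →ₗ[R] Z) : Prop where
  comp_eq_zero : g ∘ₗ f = 0
  exists_lift : ∀ {A B : Type u} (r : A → (B →₀ R)) (T : Finset A) (v : (B →₀ R) →ₗ[R] Y),
    g ∘ₗ v = 0 → (∀ a ∈ T, v (r a) = 0) →
      ∃ w : (B →₀ R) →ₗ[R] X, f ∘ₗ w = v ∧ ∀ a ∈ T, w (r a) = 0

/-- The embedding of a module in its double character module is pure: finitely many linear
equations over `D` that are solvable in `D⋆⋆` are solvable in `D`. -/
lemma exists_solution_of_bidual {D : Type u} [AddCommGroup D] [Module R D] {A B : Type u}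
    (r : A → (B →₀ R)) (T : Finset A) (z : A → D) (v : (B →₀ R) →ₗ[R] CharL (CharR D))
    (hv : ∀ a ∈ T, v (r a) = bidualMap R D (z a)) :
    ∃ w : (B →₀ R) →ₗ[R] D, ∀ a ∈ T, w (r a) = z a := by
  classical
  let ρ : ((B →₀ R) →ₗ[R] D) →+ (A → D) :=
    AddMonoidHom.mk' (fun χ a => if a ∈ T then χ (r a) else 0) fun χ χ' => by
      ext a
      by_cases ha : a ∈ T <;> simp [ha]
  let z' : A → D := fun a => if a ∈ T then z a else 0
  have hz : ∀ (c : (A → D) →+ QZ) (y : A → D),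
      c (fun a => if a ∈ T then y a else 0) = ∑ a ∈ T, c (Pi.single a (y a)) := fun c y => by
    rw [← map_sum]
    congr 1
    ext a
    simp [Finset.sum_apply, Pi.single_apply]
  by_cases h : z' ∈ ρ.range
  · obtain ⟨w, hw⟩ := h
    exact ⟨w, fun a ha => by simpa [ρ, z', ha] using congrFun hw a⟩
  · exfalso
    obtain ⟨c, hc, hne⟩ := exists_character_ne_zero h
    let c' : A → CharR D := fun a => c.comp (AddMonoidHom.single (fun _ : A => D) a)
    -- the character `c` of `D ^ T`, read as an element of `D⋆ ⊗ R^(B)` by means of the relations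
    let t : Tensor R (CharR D) (B →₀ R) := ∑ a ∈ T, tmul (c' a) (r a)
    have ht : t = 0 := tensor_charR_eq_zero fun χ => by
      rw [map_sum]
      exact (hz c fun a => χ (r a)).symm.trans (hc _ ⟨χ, rfl⟩)
    apply hne
    have h1 := congrArg (tensorCharacter v) ht
    rw [map_sum, map_zero] at h1
    refine (hz c z).trans (Eq.trans (Finset.sum_congr rfl fun a ha => ?_) h1)
    rw [tensorCharacter_tmul, hv a ha]
    rfl

/-- The cokernel of the embedding of a module in its double character module. -/
abbrev BidualQuotient (R : Type u) [Ring R] (D : Type u) [AddCommGroup D] [Module R D] : Type u :=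
  CharL (CharR D) ⧸ LinearMap.range (bidualMap R D)

lemma exists_lift_bidualQuotient {D : Type u} [AddCommGroup D] [Module R D] {A B : Type u}
    (r : A → (B →₀ R)) (T : Finset A) (v : (B →₀ R) →ₗ[R] BidualQuotient R D)
    (hv : ∀ a ∈ T, v (r a) = 0) :
    ∃ w : (B →₀ R) →ₗ[R] CharL (CharR D),
      (LinearMap.range (bidualMap R D)).mkQ ∘ₗ w = v ∧ ∀ a ∈ T, w (r a) = 0 := by
  obtain ⟨v₀, hv₀⟩ := Module.projective_lifting_property (LinearMap.range (bidualMap R D)).mkQ v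
    (Submodule.mkQ_surjective _)
  have h : ∀ a : A, ∃ z : D, a ∈ T → v₀ (r a) = bidualMap R D z := fun a => by
    by_cases ha : a ∈ T
    · have h1 : (LinearMap.range (bidualMap R D)).mkQ (v₀ (r a)) = 0 :=
        (LinearMap.congr_fun hv₀ (r a)).trans (hv a ha)
      obtain ⟨z, hz⟩ := (Submodule.Quotient.mk_eq_zero _).1 h1
      exact ⟨z, fun _ => hz.symm⟩
    · exact ⟨0, fun h => absurd h ha⟩
  choose z hz using h
  obtain ⟨w, hw⟩ := exists_solution_of_bidual r T z v₀ hz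
  refine ⟨v₀ - bidualMap R D ∘ₗ w, ?_, fun a ha => ?_⟩
  · rw [LinearMap.comp_sub, hv₀, ← LinearMap.comp_assoc, LinearMap.range_mkQ_comp,
      LinearMap.zero_comp, sub_zero]
  · rw [LinearMap.sub_apply, LinearMap.comp_apply, hw a ha, hz a ha, sub_self]

/-- Local exactness passes from `D⋆` to the character module of the cokernel of `D → D⋆⋆`. -/
lemma LocallyExact.charR_bidualQuotient {A B C : Type u} {d' : (A →₀ R) →ₗ[R] (B →₀ R)}
    {d : (B →₀ R) →ₗ[R] (C →₀ R)} {D : Type u} [AddCommGroup D] [Module R D]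
    (h : LocallyExact d' d (CharR D)) : LocallyExact d' d (CharR (BidualQuotient R D)) := by
  refine LocallyExtending.locallyExact fun S => ?_
  obtain ⟨T, hT⟩ := h.locallyExtending S
  refine ⟨T, fun χ hχ => ?_⟩
  obtain ⟨w, rfl, hw⟩ := exists_lift_bidualQuotient _ T χ hχ
  obtain ⟨θ, hθ⟩ := hT w hw
  exact ⟨(LinearMap.range (bidualMap R D)).mkQ ∘ₗ θ, fun b hb => by
    rw [LinearMap.comp_apply, hθ b hb, LinearMap.comp_apply]⟩

end Purity

/-! ### Chain maps from free complexes to pure acyclic complexes -/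

section Homotopy

variable {R : Type u} [Ring R]

section Proj

variable {B : Type u} {X : Type u} [AddCommGroup X] [Module R X]

open Classical in
/-- The projection of a free module to the span of the basis elements in `S`. -/
def basisProj (R : Type u) [Ring R] (S : Set B) : (B →₀ R) →ₗ[R] (B →₀ R) :=
  Finsupp.linearCombination R fun b => if b ∈ S then Finsupp.single b 1 else 0

lemma basisProj_single_of_mem {S : Set B} {b : B} (hb : b ∈ S) :
    basisProj R S (Finsupp.single b 1) = Finsupp.single b 1 := by
  simp [basisProj, hb]

lemma basisProj_single_of_notMem {S : Set B} {b : B} (hb : b ∉ S) :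
    basisProj R S (Finsupp.single b 1) = 0 := by
  simp [basisProj, hb]

lemma linearMap_eq_of_support {f g : (B →₀ R) →ₗ[R] X} {p : B →₀ R}
    (h : ∀ b ∈ p.support, f (Finsupp.single b 1) = g (Finsupp.single b 1)) : f p = g p := by
  rw [← Finsupp.sum_single p, Finsupp.sum, map_sum, map_sum]
  refine Finset.sum_congr rfl fun b hb => ?_
  rw [← mul_one (p b), ← smul_eq_mul, ← Finsupp.smul_single, map_smul, map_smul, h b hb]

lemma basisProj_eq_self {S : Set B} {p : B →₀ R} (h : ↑p.support ⊆ S) : basisProj R S p = p :=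
  linearMap_eq_of_support (g := LinearMap.id) fun _ hb => basisProj_single_of_mem (h hb)

lemma basisProj_eq_zero {S : Set B} {p : B →₀ R} (h : ↑p.support ⊆ Sᶜ) : basisProj R S p = 0 :=
  linearMap_eq_of_support (g := 0) fun _ hb => basisProj_single_of_notMem (h hb)

lemma support_basisProj_subset (S : Set B) (p : B →₀ R) :
    (basisProj R S p).support ⊆ p.support := by
  intro b hb
  by_contra hp
  rw [Finsupp.mem_support_iff] at hb
  refine hb (linearMap_eq_of_support (f := Finsupp.lapply b ∘ₗ basisProj R S) (g := 0)
    fun c hc => ?_)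
  have hcb : c ≠ b := fun h => hp (h ▸ hc)
  by_cases hcS : c ∈ S
  · simp [basisProj_single_of_mem hcS, hcb.symm]
  · simp [basisProj_single_of_notMem hcS]

end Proj

variable {B : ℕ → Type u} {d : ∀ k, (B k →₀ R) →ₗ[R] (B (k + 1) →₀ R)}
  {X : ℕ → ModuleCat.{u} R} {δ : ∀ k, X k →ₗ[R] X (k + 1)}
  {f : ∀ k, (B (k + 1) →₀ R) →ₗ[R] X (k + 1)}

/-- A chain map to a pure acyclic complex is null-homotopic on a subcomplex that is spanned in each
degree by finitely many basis elements. The choices in different degrees are independent of each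
other. -/
lemma exists_homotopy_on_finite (hd : ∀ k, d (k + 1) ∘ₗ d k = 0)
    (hδ : ∀ k, PureExact (δ k) (δ (k + 1)))
    (hf : ∀ k, δ (k + 1) ∘ₗ f k = f (k + 1) ∘ₗ d (k + 1))
    (N : ∀ k, Finset (B k))
    (hN : ∀ k, ∀ a ∈ N k, (d k (Finsupp.single a 1)).support ⊆ N (k + 1)) :
    ∃ s : ∀ k, (B (k + 1) →₀ R) →ₗ[R] X k, ∀ k, ∀ a ∈ N (k + 1),
      f k (Finsupp.single a 1) =
        s (k + 1) (d (k + 1) (Finsupp.single a 1)) + δ k (s k (Finsupp.single a 1)) := by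
  have hdd : ∀ k x, d (k + 1) (d k x) = 0 := fun k x => LinearMap.congr_fun (hd k) x
  have hff : ∀ k x, δ (k + 1) (f k x) = f (k + 1) (d (k + 1) x) := fun k x =>
    LinearMap.congr_fun (hf k) x
  have hδδ : ∀ k x, δ (k + 1) (δ k x) = 0 := fun k x =>
    LinearMap.congr_fun (hδ k).comp_eq_zero x
  -- `f k` is replaced, modulo the kernel of `δ (k + 1)`, by a map `r k` that vanishes on the
  -- boundaries of the basis elements in `N k`; the difference is then `δ k ∘ v k`
  choose r hr hrN using fun k => (hδ (k + 1)).exists_lift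
    (fun a : B k => d k (Finsupp.single a 1)) (N k) (δ (k + 1) ∘ₗ f k)
    (LinearMap.ext fun x => hδδ _ _)
    (fun a _ => by rw [LinearMap.comp_apply, hff, hdd, map_zero])
  have hr' : ∀ k x, δ (k + 1) (r k x) = δ (k + 1) (f k x) := fun k x =>
    LinearMap.congr_fun (hr k) x
  choose v hv _ using fun k => (hδ k).exists_lift
    (fun a : B k => d k (Finsupp.single a 1)) ∅ (f k - r k)
    (LinearMap.ext fun x => by simp [hr']) (by simp)
  have hv' : ∀ k x, δ k (v k x) = f k x - r k x := fun k x => LinearMap.congr_fun (hv k) x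
  -- the maps `v` are a homotopy up to an error that is lifted to a map `t k` vanishing on the same
  -- boundaries, so that `t (k + 1) ∘ d (k + 1)` contributes nothing
  choose t ht htN using fun k => (hδ k).exists_lift
    (fun a : B k => d k (Finsupp.single a 1)) (N k)
    ((r k - v (k + 1) ∘ₗ d (k + 1)) ∘ₗ basisProj R (N (k + 1) : Set (B (k + 1))))
    (by
      refine Finsupp.lhom_ext' fun b => LinearMap.ext_ring ?_
      simp only [LinearMap.comp_apply, Finsupp.lsingle_apply, LinearMap.sub_apply, map_sub,
        LinearMap.zero_apply]
      by_cases hb : b ∈ N (k + 1)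
      · rw [basisProj_single_of_mem (by simpa using hb), hr', hv', hff, sub_sub_cancel,
          hrN (k + 1) b hb]
      · rw [basisProj_single_of_notMem (by simpa using hb)]
        simp)
    (fun a ha => by
      rw [LinearMap.comp_apply, basisProj_eq_self (by simpa using hN k a ha)]
      simp [hrN k a ha, hdd])
  refine ⟨fun k => v k + t k, fun k a ha => ?_⟩
  have h1 := LinearMap.congr_fun (ht k) (Finsupp.single a 1)
  simp only [LinearMap.comp_apply, LinearMap.sub_apply,
    basisProj_single_of_mem (Finset.mem_coe.2 ha)] at h1
  rw [LinearMap.add_apply, LinearMap.add_apply, map_add, hv', h1, htN (k + 1) a ha]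
  abel

/-- A homotopy from `f` to zero on the subcomplex spanned by subsets of the bases. The homotopies
are defined everywhere, but only their values on the subsets matter. -/
structure PartialHomotopy (d : ∀ k, (B k →₀ R) →ₗ[R] (B (k + 1) →₀ R))
    (δ : ∀ k, X k →ₗ[R] X (k + 1)) (f : ∀ k, (B (k + 1) →₀ R) →ₗ[R] X (k + 1)) where
  /-- The basis elements that span the subcomplex. -/
  carrier : ∀ k, Set (B k)
  /-- The homotopy. -/
  s : ∀ k, (B (k + 1) →₀ R) →ₗ[R] X k
  closed : ∀ k, ∀ b ∈ carrier k, ↑(d k (Finsupp.single b 1)).support ⊆ carrier (k + 1)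
  eq : ∀ k, ∀ b ∈ carrier (k + 1), f k (Finsupp.single b 1) =
    s (k + 1) (d (k + 1) (Finsupp.single b 1)) + δ k (s k (Finsupp.single b 1))

/-- One partial homotopy extends another one. -/
def PartialHomotopy.Le (p q : PartialHomotopy d δ f) : Prop :=
  (∀ k, p.carrier k ⊆ q.carrier k) ∧
    ∀ k, ∀ b ∈ p.carrier (k + 1), p.s k (Finsupp.single b 1) = q.s k (Finsupp.single b 1)

lemma PartialHomotopy.exists_upper_bound (c : Set (PartialHomotopy d δ f))
    (hc : IsChain PartialHomotopy.Le c) : ∃ q, ∀ p ∈ c, PartialHomotopy.Le p q := by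
  classical
  let S : ∀ k, Set (B k) := fun k => {b | ∃ p ∈ c, b ∈ p.carrier k}
  let s : ∀ k, (B (k + 1) →₀ R) →ₗ[R] X k := fun k => Finsupp.linearCombination R fun b =>
    if h : ∃ p ∈ c, b ∈ p.carrier (k + 1) then h.choose.s k (Finsupp.single b 1) else 0
  have hs : ∀ p ∈ c, ∀ k, ∀ b ∈ p.carrier (k + 1),
      p.s k (Finsupp.single b 1) = s k (Finsupp.single b 1) := by
    intro p hp k b hb
    have h : ∃ p ∈ c, b ∈ p.carrier (k + 1) := ⟨p, hp, hb⟩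
    have : s k (Finsupp.single b 1) = h.choose.s k (Finsupp.single b 1) := by
      simp only [s, Finsupp.linearCombination_single, one_smul, dif_pos h]
    rw [this]
    obtain ⟨hq, hbq⟩ := h.choose_spec
    by_cases hpq : p = h.choose
    · rw [← hpq]
    · rcases hc hp hq hpq with hle | hle
      · exact hle.2 k b hb
      · exact (hle.2 k b hbq).symm
  refine ⟨⟨S, s, ?_, ?_⟩, fun p hp => ⟨fun k b hb => ⟨p, hp, hb⟩, hs p hp⟩⟩
  · rintro k b ⟨p, hp, hb⟩ x hx
    exact ⟨p, hp, p.closed k b hb hx⟩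
  · rintro k b ⟨p, hp, hb⟩
    rw [p.eq k b hb, hs p hp k b hb]
    congr 1
    exact linearMap_eq_of_support fun x hx => hs p hp (k + 1) x (p.closed (k + 1) b hb hx)

/-- A family of finite sets of basis elements, containing a given one, whose span is a
subcomplex. -/
lemma exists_finite_closed (d : ∀ k, (B k →₀ R) →ₗ[R] (B (k + 1) →₀ R)) (j : ℕ) (b₀ : B j) :
    ∃ N : ∀ k, Finset (B k), b₀ ∈ N j ∧
      ∀ k, ∀ a ∈ N k, (d k (Finsupp.single a 1)).support ⊆ N (k + 1) := by
  classical
  let init : ∀ k, Finset (B k) := fun k => if h : j = k then {h ▸ b₀} else ∅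
  let N : ∀ k, Finset (B k) := fun k => Nat.rec (motive := fun k => Finset (B k)) (init 0)
    (fun k T => init (k + 1) ∪ T.biUnion fun a => (d k (Finsupp.single a 1)).support) k
  refine ⟨N, ?_, fun k a ha => ?_⟩
  · have h : b₀ ∈ init j := by simp [init]
    cases j with
    | zero => exact h
    | succ j => exact Finset.mem_union_left _ h
  · exact (Finset.subset_biUnion_of_mem (fun a => (d k (Finsupp.single a 1)).support) ha).trans
      Finset.subset_union_right

/-- A partial homotopy extends to any further basis element: modulo the span of its carrier, that
element generates a subcomplex with finitely generated terms. -/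
lemma PartialHomotopy.exists_extension (hd : ∀ k, d (k + 1) ∘ₗ d k = 0)
    (hδ : ∀ k, PureExact (δ k) (δ (k + 1)))
    (hf : ∀ k, δ (k + 1) ∘ₗ f k = f (k + 1) ∘ₗ d (k + 1))
    (p : PartialHomotopy d δ f) (j : ℕ) (b₀ : B j) :
    ∃ q, PartialHomotopy.Le p q ∧ b₀ ∈ q.carrier j := by
  obtain ⟨N, hb₀, hN⟩ := exists_finite_closed d j b₀
  have hdd : ∀ k x, d (k + 1) (d k x) = 0 := fun k x => LinearMap.congr_fun (hd k) x
  have hff : ∀ k x, δ (k + 1) (f k x) = f (k + 1) (d (k + 1) x) := fun k x =>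
    LinearMap.congr_fun (hf k) x
  have hδδ : ∀ k x, δ (k + 1) (δ k x) = 0 := fun k x =>
    LinearMap.congr_fun (hδ k).comp_eq_zero x
  -- the quotient complex by the span of `p.carrier`, realized by a projection, and the map
  -- induced on it by the difference of `f` and the boundary of the homotopy
  let π : ∀ k, (B k →₀ R) →ₗ[R] (B k →₀ R) := fun k => basisProj R (p.carrier k)ᶜ
  have hπd : ∀ k, ∀ b ∈ p.carrier k, π (k + 1) (d k (Finsupp.single b 1)) = 0 := fun k b hb =>
    basisProj_eq_zero (by rw [compl_compl]; exact p.closed k b hb)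
  have hπdπ : ∀ k x, π (k + 1) (d k (π k x)) = π (k + 1) (d k x) := fun k x => by
    refine linearMap_eq_of_support (f := π (k + 1) ∘ₗ d k ∘ₗ π k) (g := π (k + 1) ∘ₗ d k)
      fun b _ => ?_
    simp only [LinearMap.comp_apply]
    by_cases hb : b ∈ p.carrier k
    · rw [hπd k b hb, show π k (Finsupp.single b 1) = 0 from
        basisProj_single_of_notMem (by simpa using hb), map_zero, map_zero]
    · rw [show π k (Finsupp.single b 1) = Finsupp.single b 1 from basisProj_single_of_mem hb]
  let g : ∀ k, (B (k + 1) →₀ R) →ₗ[R] X (k + 1) := fun k =>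
    f k - p.s (k + 1) ∘ₗ d (k + 1) - δ k ∘ₗ p.s k
  have hg : ∀ k, ∀ b ∈ p.carrier (k + 1), g k (Finsupp.single b 1) = 0 := fun k b hb => by
    simp only [g, LinearMap.sub_apply, LinearMap.comp_apply, p.eq k b hb]
    abel
  have hgπ : ∀ k x, g k (π (k + 1) x) = g k x := fun k x => by
    refine linearMap_eq_of_support (f := g k ∘ₗ π (k + 1)) (g := g k) fun b _ => ?_
    simp only [LinearMap.comp_apply]
    by_cases hb : b ∈ p.carrier (k + 1)
    · rw [hg k b hb, show π (k + 1) (Finsupp.single b 1) = 0 from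
        basisProj_single_of_notMem (by simpa using hb), map_zero]
    · rw [show π (k + 1) (Finsupp.single b 1) = Finsupp.single b 1 from basisProj_single_of_mem hb]
  obtain ⟨s, hs⟩ := exists_homotopy_on_finite (d := fun k => π (k + 1) ∘ₗ d k) (f := g)
    (fun k => LinearMap.ext fun x => by
      simp only [LinearMap.comp_apply]
      rw [hπdπ, hdd, map_zero, LinearMap.zero_apply]) hδ
    (fun k => LinearMap.ext fun x => by
      simp only [LinearMap.comp_apply]
      rw [hgπ]
      simp only [g, LinearMap.sub_apply, LinearMap.comp_apply, map_sub, hff, hδδ, hdd, map_zero]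
      abel)
    N (fun k a ha => (support_basisProj_subset _ _).trans (hN k a ha))
  refine ⟨⟨fun k => p.carrier k ∪ N k, fun k => p.s k + s k ∘ₗ π (k + 1), ?_, ?_⟩,
    ⟨fun k => Set.subset_union_left, fun k b hb => ?_⟩, Or.inr hb₀⟩
  · rintro k b (hb | hb)
    · exact (p.closed k b hb).trans Set.subset_union_left
    · exact (Finset.coe_subset.2 (hN k b hb)).trans Set.subset_union_right
  · intro k b hb'
    simp only [LinearMap.add_apply, LinearMap.comp_apply]
    by_cases hb : b ∈ p.carrier (k + 1)
    · rw [hπd (k + 1) b hb, show π (k + 1) (Finsupp.single b 1) = 0 from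
        basisProj_single_of_notMem (by simpa using hb), map_zero, map_zero, add_zero, add_zero]
      exact p.eq k b hb
    · have h1 := hs k b (hb'.resolve_left hb)
      rw [show π (k + 1) (Finsupp.single b 1) = Finsupp.single b 1 from basisProj_single_of_mem hb]
      simp only [g, LinearMap.sub_apply, LinearMap.comp_apply] at h1
      rw [sub_sub, sub_eq_iff_eq_add] at h1
      rw [h1, map_add]
      abel
  · rw [LinearMap.add_apply, LinearMap.comp_apply, show π (k + 1) (Finsupp.single b 1) = 0 from
        basisProj_single_of_notMem (by simpa using hb), map_zero, add_zero]

/-- Any chain map from a complex of free modules to a pure acyclic complex is null-homotopic.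
The complex of free modules is exhausted by subcomplexes whose successive quotients are finitely
generated in each degree, because the boundary of a basis element has finite support. -/
theorem exists_homotopy (hd : ∀ k, d (k + 1) ∘ₗ d k = 0)
    (hδ : ∀ k, PureExact (δ k) (δ (k + 1)))
    (hf : ∀ k, δ (k + 1) ∘ₗ f k = f (k + 1) ∘ₗ d (k + 1)) :
    ∃ s : ∀ k, (B (k + 1) →₀ R) →ₗ[R] X k, ∀ k, f k = s (k + 1) ∘ₗ d (k + 1) + δ k ∘ₗ s k := by
  obtain ⟨m, hm⟩ := exists_maximal_of_chains_bounded
    (PartialHomotopy.exists_upper_bound (d := d) (δ := δ) (f := f))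
    fun {p q r} hpq hqr => ⟨fun k => (hpq.1 k).trans (hqr.1 k), fun k b hb =>
      (hpq.2 k b hb).trans (hqr.2 k b (hpq.1 _ hb))⟩
  have hall : ∀ k (b : B k), b ∈ m.carrier k := fun k b => by
    obtain ⟨q, hq, hb⟩ := m.exists_extension hd hδ hf k b
    exact (hm q hq).1 k hb
  refine ⟨m.s, fun k => Finsupp.lhom_ext' fun b => LinearMap.ext_ring ?_⟩
  exact m.eq k b (hall _ b)

end Homotopy

/-! ### Pure coresolutions by double character modules -/

section Coresolution

variable {R : Type u} [Ring R]

/-- The iterated cokernels of embeddings in double character modules. -/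
def bidualCosyzygy (D : ModuleCat.{u} R) : ℕ → ModuleCat.{u} R
  | 0 => D
  | k + 1 => ModuleCat.of R (BidualQuotient R (bidualCosyzygy D k))

/-- The terms of the pure coresolution `0 → D → D⋆⋆ → (D⋆⋆/D)⋆⋆ → ⋯`; the leading `0` has
degree `0`. -/
def bidualComplex (D : ModuleCat.{u} R) : ℕ → ModuleCat.{u} R
  | 0 => ModuleCat.of R PUnit
  | 1 => D
  | k + 2 => ModuleCat.of R (CharL (CharR (bidualCosyzygy D k)))

/-- The differentials of `bidualComplex`. -/
def bidualD (D : ModuleCat.{u} R) : ∀ k, bidualComplex D k →ₗ[R] bidualComplex D (k + 1)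
  | 0 => 0
  | 1 => bidualMap R D
  | k + 2 => bidualMap R (BidualQuotient R (bidualCosyzygy D k)) ∘ₗ
      (LinearMap.range (bidualMap R (bidualCosyzygy D k))).mkQ

lemma pureExact_zero_bidualMap (D : Type u) [AddCommGroup D] [Module R D] :
    PureExact (0 : PUnit.{u + 1} →ₗ[R] D) (bidualMap R D) :=
  ⟨LinearMap.comp_zero _, fun _ _ _ hv _ => ⟨0, LinearMap.ext fun x =>
    (bidualMap_injective D ((LinearMap.congr_fun hv x).trans (map_zero _).symm)).symm,
    fun _ _ => rfl⟩⟩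

lemma bidualMap_comp_mkQ_comp_bidualMap (D : Type u) [AddCommGroup D] [Module R D] :
    (bidualMap R (BidualQuotient R D) ∘ₗ (LinearMap.range (bidualMap R D)).mkQ) ∘ₗ bidualMap R D =
      0 := by
  rw [LinearMap.comp_assoc, LinearMap.range_mkQ_comp, LinearMap.comp_zero]

/-- The kernel of `D⋆⋆ → (D⋆⋆/D)⋆⋆` is `D`. -/
lemma exists_bidualMap_comp_eq {D P : Type u} [AddCommGroup D] [Module R D] [AddCommGroup P]
    [Module R P] (v : P →ₗ[R] CharL (CharR D))
    (hv : (bidualMap R (BidualQuotient R D) ∘ₗ (LinearMap.range (bidualMap R D)).mkQ) ∘ₗ v = 0) :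
    ∃ w : P →ₗ[R] D, bidualMap R D ∘ₗ w = v := by
  have hker : ∀ x, v x ∈ LinearMap.range (bidualMap R D) := fun x => by
    rw [← Submodule.Quotient.mk_eq_zero]
    exact bidualMap_injective _ ((LinearMap.congr_fun hv x).trans (map_zero _).symm)
  let e := LinearEquiv.ofInjective (bidualMap R D) (bidualMap_injective D)
  exact ⟨e.symm.toLinearMap ∘ₗ v.codRestrict _ hker, LinearMap.ext fun x =>
    congrArg Subtype.val (e.apply_symm_apply ⟨v x, hker x⟩)⟩

lemma pureExact_bidualMap (D : Type u) [AddCommGroup D] [Module R D] :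
    PureExact (bidualMap R D)
      (bidualMap R (BidualQuotient R D) ∘ₗ (LinearMap.range (bidualMap R D)).mkQ) := by
  refine ⟨bidualMap_comp_mkQ_comp_bidualMap D, fun {A B} r T v hv hr => ?_⟩
  obtain ⟨w, rfl⟩ := exists_bidualMap_comp_eq v hv
  exact ⟨w, rfl, fun a ha => bidualMap_injective D ((hr a ha).trans (map_zero _).symm)⟩

lemma pureExact_bidualMap_comp_mkQ (D : Type u) [AddCommGroup D] [Module R D] :
    PureExact (bidualMap R (BidualQuotient R D) ∘ₗ (LinearMap.range (bidualMap R D)).mkQ)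
      (bidualMap R (BidualQuotient R (BidualQuotient R D)) ∘ₗ
        (LinearMap.range (bidualMap R (BidualQuotient R D))).mkQ) := by
  constructor
  · rw [← LinearMap.comp_assoc, bidualMap_comp_mkQ_comp_bidualMap, LinearMap.zero_comp]
  · intro A B r T v hv hr
    obtain ⟨v, rfl⟩ := exists_bidualMap_comp_eq v hv
    obtain ⟨w, rfl, hw⟩ := exists_lift_bidualQuotient r T v fun a ha =>
      bidualMap_injective _ ((hr a ha).trans (map_zero _).symm)
    exact ⟨w, rfl, hw⟩

lemma pureExact_bidualD (D : ModuleCat.{u} R) : ∀ k,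
    PureExact (bidualD D k) (bidualD D (k + 1))
  | 0 => pureExact_zero_bidualMap D
  | 1 => pureExact_bidualMap D
  | k + 2 => pureExact_bidualMap_comp_mkQ (bidualCosyzygy D k)

lemma exists_dependent_seq {σ : ℕ → Type*} (x₀ : σ 0) {r : ∀ k, σ k → σ (k + 1) → Prop}
    (h : ∀ k x, ∃ y, r k x y) : ∃ x : ∀ k, σ k, x 0 = x₀ ∧ ∀ k, r k (x k) (x (k + 1)) := by
  choose F hF using h
  exact ⟨fun k => Nat.rec x₀ (fun k x => F k x) k, rfl, fun k => hF k _⟩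

/-- If `D⋆` is locally exact, then a homomorphism to `D` that vanishes on the boundaries factors
through the next term of the complex of free modules: it extends to a chain map to the pure
coresolution of `D` by double character modules, which is null-homotopic. -/
theorem exists_factor_of_locallyExact {B : ℕ → Type u}
    {d : ∀ k, (B k →₀ R) →ₗ[R] (B (k + 1) →₀ R)} (hd : ∀ k, d (k + 1) ∘ₗ d k = 0)
    (D : ModuleCat.{u} R) (hD : ∀ k, LocallyExact (d k) (d (k + 1)) (CharR D))
    (χ : (B 1 →₀ R) →ₗ[R] D) (hχ : χ ∘ₗ d 0 = 0) :
    ∃ θ : (B 2 →₀ R) →ₗ[R] D, χ = θ ∘ₗ d 1 := by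
  have hC : ∀ j k, LocallyExact (d k) (d (k + 1)) (CharR (bidualCosyzygy D j)) := by
    intro j
    induction j with
    | zero => exact hD
    | succ j ih => exact fun k => (ih k).charR_bidualQuotient
  let σ : ℕ → Type u := fun k =>
    {f : (B (k + 1) →₀ R) →ₗ[R] bidualComplex D (k + 1) // bidualD D (k + 1) ∘ₗ f ∘ₗ d k = 0}
  obtain ⟨f, hf0, hf⟩ := exists_dependent_seq (σ := σ)
    ⟨χ, (congrArg (fun f => bidualMap R D ∘ₗ f) hχ).trans (LinearMap.comp_zero _)⟩
    (r := fun k x y => bidualD D (k + 1) ∘ₗ x.1 = y.1 ∘ₗ d (k + 1)) fun k x => by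
      obtain ⟨y, hy⟩ := ((lTensor_exact_iff _ _).1 ((hC k k).exact (hd k))
        (bidualD D (k + 1) ∘ₗ x.1)).1 x.2
      refine ⟨⟨y, ?_⟩, hy.symm⟩
      have hy' : y ∘ₗ d (k + 1) = bidualD D (k + 1) ∘ₗ x.1 := hy
      refine (congrArg (fun f => bidualD D (k + 1 + 1) ∘ₗ f) hy').trans ?_
      rw [← LinearMap.comp_assoc, (pureExact_bidualD D (k + 1)).comp_eq_zero, LinearMap.zero_comp]
  obtain ⟨s, hs⟩ := exists_homotopy hd (pureExact_bidualD D) (f := fun k => (f k).1) hf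
  refine ⟨s 1, ?_⟩
  have h0 := hs 0
  have h1 : bidualD D 0 ∘ₗ s 0 = 0 := LinearMap.zero_comp _
  rw [h1, add_zero, hf0] at h0
  exact h0

end Coresolution

/-! ### Passage from projective to free modules -/

section Free

variable {R : Type u} [Ring R]

/-- Eilenberg's swindle: a projective module becomes free when a suitable free module is added. -/
lemma exists_free_prod (P : Type u) [AddCommGroup P] [Module R P] [Module.Projective R P] :
    ∃ K : ModuleCat.{u} R, Module.Free R K ∧ Module.Free R (P × K) := by
  obtain ⟨s, hs⟩ := Module.projective_def'.1 (‹Module.Projective R P›)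
  let p : (P →₀ R) →ₗ[R] P := Finsupp.linearCombination R id
  have hps : ∀ x, p (s x) = x := fun x => LinearMap.congr_fun hs x
  -- for `F = R^(P)` we have `F ≃ P ⊕ ker p`; the copies of `P` in `F^(ℕ)` are shifted by one place
  let φ₂ : (ℕ →₀ P →₀ R) →ₗ[R] (ℕ →₀ P →₀ R) := Finsupp.lsum ℕ fun n =>
    Finsupp.lsingle n ∘ₗ (LinearMap.id - s ∘ₗ p) + Finsupp.lsingle (n + 1) ∘ₗ s ∘ₗ p
  let φ : P × (ℕ →₀ P →₀ R) →ₗ[R] (ℕ →₀ P →₀ R) := LinearMap.coprod (Finsupp.lsingle 0 ∘ₗ s) φ₂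
  let ψ : (ℕ →₀ P →₀ R) →ₗ[R] P × (ℕ →₀ P →₀ R) := Finsupp.lsum ℕ fun n =>
    LinearMap.prod (if n = 0 then p else 0) (Finsupp.lsingle n ∘ₗ (LinearMap.id - s ∘ₗ p) +
      if n = 0 then 0 else Finsupp.lsingle (n - 1) ∘ₗ s ∘ₗ p)
  have hφ₂ : ∀ n y, φ₂ (Finsupp.single n y) =
      Finsupp.single n (y - s (p y)) + Finsupp.single (n + 1) (s (p y)) := fun n y => by
    simp [φ₂]
  have hφ : ∀ x g, φ (x, g) = Finsupp.single 0 (s x) + φ₂ g := fun x g => rfl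
  have hψ₀ : ∀ y, ψ (Finsupp.single 0 y) = (p y, Finsupp.single 0 (y - s (p y))) := fun y => by
    simp [ψ]
  have hψ : ∀ n y, ψ (Finsupp.single (n + 1) y) =
      (0, Finsupp.single (n + 1) (y - s (p y)) + Finsupp.single n (s (p y))) := fun n y => by
    simp [ψ]
  have h1 : φ ∘ₗ ψ = LinearMap.id := by
    refine Finsupp.lhom_ext fun n y => ?_
    rw [LinearMap.comp_apply, LinearMap.id_apply]
    rcases n with _ | n
    · rw [hψ₀, hφ, hφ₂]
      simp [hps, -Finsupp.single_sub, ← Finsupp.single_add]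
    · rw [hψ, hφ, map_add, hφ₂, hφ₂]
      simp [hps, -Finsupp.single_sub, ← Finsupp.single_add]
  have h2 : ψ ∘ₗ φ = LinearMap.id := by
    refine LinearMap.prod_ext (LinearMap.ext fun x => ?_) (Finsupp.lhom_ext fun n y => ?_)
    · change ψ (φ (x, 0)) = (x, 0)
      rw [hφ, map_zero, add_zero, hψ₀]
      simp [hps]
    · change ψ (φ (0, Finsupp.single n y)) = (0, Finsupp.single n y)
      rw [hφ, map_zero, Finsupp.single_zero, zero_add, hφ₂, map_add, hψ]
      rcases n with _ | n
      · rw [hψ₀]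
        simp [hps, -Finsupp.single_sub, ← Finsupp.single_add]
      · rw [hψ]
        simp [hps, -Finsupp.single_sub, ← Finsupp.single_add]
  exact ⟨ModuleCat.of R (ℕ →₀ P →₀ R), inferInstanceAs (Module.Free R (ℕ →₀ P →₀ R)),
    Module.Free.of_equiv (LinearEquiv.ofLinearMap ψ φ h2 h1)⟩

end Free

/-! ### PGF-modules are Gorenstein projective -/

section HomAcyclic

variable {R : Type u} [Ring R]

/-- The differential `M a → M b` of a complex indexed by `ℤ`, for indices with `a = b + 1` that
need not be of the form `i + 1` and `i` syntactically. -/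
def differentialOfEq {M : ℤ → ModuleCat.{u} R} (D : ∀ i, M (i + 1) →ₗ[R] M i) {a b : ℤ}
    (h : a = b + 1) : M a →ₗ[R] M b := by
  subst h
  exact D b

lemma differentialOfEq_comp {M : ℤ → ModuleCat.{u} R} {D : ∀ i, M (i + 1) →ₗ[R] M i}
    (hD : ∀ i, D i ∘ₗ D (i + 1) = 0) {a b c : ℤ} (hab : a = b + 1) (hbc : b = c + 1) :
    differentialOfEq D hbc ∘ₗ differentialOfEq D hab = 0 := by
  subst hbc
  subst hab
  exact hD c

lemma exists_factor_differentialOfEq {M : ℤ → ModuleCat.{u} R} {D : ∀ i, M (i + 1) →ₗ[R] M i}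
    {V : Type u} [AddCommGroup V] [Module R V]
    (hV : ∀ (i : ℤ) (f : M (i + 1) →ₗ[R] V), f ∘ₗ D (i + 1) = 0 → ∃ g : M i →ₗ[R] V, g ∘ₗ D i = f)
    {a b c : ℤ} (hab : a = b + 1) (hbc : b = c + 1) (f : M b →ₗ[R] V)
    (hf : f ∘ₗ differentialOfEq D hab = 0) :
    ∃ g : M c →ₗ[R] V, g ∘ₗ differentialOfEq D hbc = f := by
  subst hbc
  subst hab
  exact hV c f hf

/-- Let `P` be an acyclic complex of projective modules such that `I ⊗ P` is acyclic for all
injective right modules `I`. Then `Hom(P, Q)` is acyclic for all projective modules `Q`. -/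
theorem AcyclicProjComplex.TensorAcyclic.homAcyclic {P : AcyclicProjComplex R}
    (hP : P.TensorAcyclic) : P.HomAcyclic := by
  intro Q hQ i
  have hdd : ∀ i x, P.d i (P.d (i + 1) x) = 0 := fun i x => (P.exact i _).2 ⟨x, rfl⟩
  intro χ
  constructor
  swap
  · rintro ⟨g, rfl⟩
    exact LinearMap.ext fun x => (congrArg g (hdd i x)).trans (map_zero g)
  intro hχ
  -- a contractible complex is added to `P` in order to make its terms free
  have := P.projective
  choose K hK hPK using fun i => exists_free_prod (R := R) (P.X i)
  let M : ℤ → ModuleCat.{u} R := fun i => ModuleCat.of R (P.X i × (K i × K (i + 1)))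
  let D : ∀ i, M (i + 1) →ₗ[R] M i := fun i =>
    LinearMap.prodMap (P.d i) (LinearMap.prod 0 (LinearMap.fst R (K (i + 1)) (K (i + 1 + 1))))
  have hfree : ∀ i, Module.Free R (M i) := fun i =>
    Module.Free.of_equiv (LinearEquiv.prodAssoc R (P.X i) (K i) (K (i + 1)))
  have hD : ∀ i, D i ∘ₗ D (i + 1) = 0 := fun i => LinearMap.ext fun x =>
    Prod.ext (hdd i x.1) rfl
  have hDV : ∀ (V : Type u) [AddCommGroup V] [Module R V],
      (∀ (i : ℤ) (f : P.X (i + 1) →ₗ[R] V), f ∘ₗ P.d (i + 1) = 0 →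
        ∃ g : P.X i →ₗ[R] V, g ∘ₗ P.d i = f) →
      ∀ (i : ℤ) (f : M (i + 1) →ₗ[R] V), f ∘ₗ D (i + 1) = 0 →
        ∃ g : M i →ₗ[R] V, g ∘ₗ D i = f := by
    intro V _ _ hV i f hf
    obtain ⟨g, hg⟩ := hV i (f ∘ₗ LinearMap.inl R _ _) (LinearMap.ext fun x =>
      LinearMap.congr_fun hf (x, (0, 0)))
    let g' : M i →ₗ[R] V := LinearMap.coprod g
      ((f ∘ₗ LinearMap.inr R _ _ ∘ₗ LinearMap.inl R _ _) ∘ₗ LinearMap.snd R _ _)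
    refine ⟨g', LinearMap.ext fun ⟨x, a, b⟩ => ?_⟩
    have hb : f (0, (0, b)) = 0 := by
      have h0 : D (i + 1) (0, (b, 0)) = (0, (0, b)) := Prod.ext (map_zero (P.d (i + 1))) rfl
      rw [← h0]
      exact LinearMap.congr_fun hf (0, (b, 0))
    have hx : g (P.d i x) = f (x, (0, 0)) := LinearMap.congr_fun hg x
    change g (P.d i x) + f (0, (a, 0)) = f (x, (a, b))
    have hsum : ((x, (a, b)) : M (i + 1)) = (x, (0, 0)) + (0, (a, 0)) + (0, (0, b)) := by
      simp
    rw [hsum, map_add, map_add, hb, hx, add_zero]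
  -- the part of the complex that starts in degree `i + 2`, in terms of bases
  let n : ℕ → ℤ
    | 0 => i + 1 + 1
    | 1 => i + 1
    | 2 => i
    | k + 3 => i - (k + 1)
  have hn : ∀ k, n k = n (k + 1) + 1
    | 0 => rfl
    | 1 => rfl
    | 2 => by simp [n]
    | k + 3 => by
      simp only [n]
      push_cast
      ring
  let e : ∀ k, M (n k) ≃ₗ[R] (Module.Free.ChooseBasisIndex R (M (n k)) →₀ R) := fun k =>
    (Module.Free.chooseBasis R (M (n k))).repr
  let d : ∀ k, (Module.Free.ChooseBasisIndex R (M (n k)) →₀ R) →ₗ[R]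
      (Module.Free.ChooseBasisIndex R (M (n (k + 1))) →₀ R) := fun k =>
    (e (k + 1)).toLinearMap ∘ₗ differentialOfEq D (hn k) ∘ₗ (e k).symm.toLinearMap
  have hd : ∀ k, d (k + 1) ∘ₗ d k = 0 := fun k => LinearMap.ext fun x => by
    have := LinearMap.congr_fun (differentialOfEq_comp hD (hn k) (hn (k + 1))) ((e k).symm x)
    simpa [d] using this
  have hJ : Module.Injective Rᵐᵒᵖ (CharR Q) := (isFlat_of_projective Q).injective_charR
  have hloc : ∀ k, LocallyExact (d k) (d (k + 1)) (CharR Q) := fun k => by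
    refine locallyExact_of_forall_pi fun S => (lTensor_exact_iff _ _).2 fun f => ⟨fun hf => ?_, ?_⟩
    · obtain ⟨g, hg⟩ := exists_factor_differentialOfEq (hDV (CharL (S → CharR Q)) fun j f hf =>
        ((lTensor_exact_iff (N := S → CharR Q) _ _).1
          (hP (ModuleCat.of Rᵐᵒᵖ (S → CharR Q)) (Module.Injective.pi _ _) j) f).1 hf)
        (hn k) (hn (k + 1)) (f ∘ₗ (e (k + 1)).toLinearMap) (LinearMap.ext fun x => by
          simpa [d] using LinearMap.congr_fun hf (e k x))
      refine ⟨g ∘ₗ (e (k + 1 + 1)).symm.toLinearMap, LinearMap.ext fun x => ?_⟩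
      simpa [d] using LinearMap.congr_fun hg ((e (k + 1)).symm x)
    · rintro ⟨g, rfl⟩
      change (g ∘ₗ d (k + 1)) ∘ₗ d k = 0
      rw [LinearMap.comp_assoc, hd k, LinearMap.comp_zero]
  obtain ⟨θ, hθ⟩ := exists_factor_of_locallyExact hd Q hloc
    ((χ ∘ₗ LinearMap.fst R _ _) ∘ₗ (e 1).symm.toLinearMap) (LinearMap.ext fun x => by
      have h1 := LinearMap.congr_fun hχ ((e 0).symm x).1
      have h2 : ∀ y, (e 1).symm (e 1 y) = y := (e 1).symm_apply_apply
      refine Eq.trans ?_ h1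
      exact congrArg (fun y : M (n 1) => χ y.1) (h2 _))
  refine ⟨θ ∘ₗ (e 2).toLinearMap ∘ₗ LinearMap.inl R _ _, LinearMap.ext fun x => ?_⟩
  have h1 := LinearMap.congr_fun hθ (e 1 (x, (0, 0)))
  have h2 : (e 1).symm (e 1 (x, (0, 0))) = (x, (0, 0)) := (e 1).symm_apply_apply _
  have h3 : χ ((e 1).symm (e 1 (x, (0, 0)))).1 = χ x := by rw [h2]
  refine Eq.trans ?_ (h1.symm.trans h3)
  change θ (e 2 (P.d i x, (0, 0))) = θ (e 2 (D i ((e 1).symm (e 1 (x, (0, 0))))))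
  rw [h2]
  rfl

lemma IsPGF.isGorensteinProjective {M : ModuleCat.{u} R} (hM : IsPGF M) :
    IsGorensteinProjective M := by
  obtain ⟨P, hP, hPM⟩ := hM
  exact ⟨P, hP.homAcyclic, hPM⟩

end HomAcyclic

/-! ### Short exact sequences and vanishing of `Ext` -/

section ShortExact

open CategoryTheory Abelian

variable {R : Type u} [Ring R]

/-- `0 → A → B → C → 0` is a short exact sequence of modules. -/
structure IsSES {A B C : ModuleCat.{u} R} (f : A →ₗ[R] B) (g : B →ₗ[R] C) : Prop where
  injective : Function.Injective f
  exact : Function.Exact f g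
  surjective : Function.Surjective g

namespace IsSES

variable {A B C : ModuleCat.{u} R} {f : A →ₗ[R] B} {g : B →ₗ[R] C}

/-- A short exact sequence of modules as a short complex in the category of modules. -/
abbrev shortComplex (h : IsSES f g) : ShortComplex (ModuleCat.{u} R) :=
  ShortComplex.mk (ModuleCat.ofHom f) (ModuleCat.ofHom g)
    (by ext x; exact h.exact.apply_apply_eq_zero x)

lemma shortExact (h : IsSES f g) : h.shortComplex.ShortExact :=
  ModuleCat.shortComplex_shortExact _ h.exact h.injective h.surjective

end IsSES

lemma IsSES.comp_equiv {A A' B C : ModuleCat.{u} R} {f : A →ₗ[R] B} {g : B →ₗ[R] C}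
    (h : IsSES f g) (e : A' ≃ₗ[R] A) : IsSES (f ∘ₗ e.toLinearMap) g := by
  refine ⟨h.injective.comp e.injective, fun x => (h.exact x).trans ⟨?_, ?_⟩, h.surjective⟩
  · rintro ⟨y, rfl⟩
    exact ⟨e.symm y, congrArg f (e.apply_symm_apply y)⟩
  · rintro ⟨y, rfl⟩
    exact ⟨e y, rfl⟩

lemma isSES_ker {B C : ModuleCat.{u} R} (g : B →ₗ[R] C) (hg : Function.Surjective g) :
    IsSES (A := ModuleCat.of R (LinearMap.ker g)) (LinearMap.ker g).subtype g :=
  ⟨Subtype.val_injective, g.exact_subtype_ker_map, hg⟩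

lemma isSES_quotient {A B : ModuleCat.{u} R} (f : A →ₗ[R] B) (hf : Function.Injective f) :
    IsSES (C := ModuleCat.of R (B ⧸ LinearMap.range f)) f (LinearMap.range f).mkQ :=
  ⟨hf, LinearMap.exact_map_mkQ_range f, Submodule.mkQ_surjective _⟩

/-- Every module is a quotient of a projective module. -/
lemma exists_isSES_projective (M : ModuleCat.{u} R) :
    ∃ (K P : ModuleCat.{u} R) (f : K →ₗ[R] P) (g : P →ₗ[R] M), Module.Projective R P ∧
      IsSES f g :=
  ⟨_, ModuleCat.of R (M →₀ R), _, Finsupp.linearCombination R (id : M → M),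
    (inferInstance : Module.Projective R (M →₀ R)),
    isSES_ker (B := ModuleCat.of R (M →₀ R)) _ (Finsupp.linearCombination_id_surjective R M)⟩

/-- Every module embeds into an injective module. -/
lemma exists_isSES_injective (M : ModuleCat.{u} R) :
    ∃ (I C : ModuleCat.{u} R) (f : M →ₗ[R] I) (g : I →ₗ[R] C), Module.Injective R I ∧
      IsSES f g := by
  let I : ModuleCat.{u} R := Injective.under (C := ModuleCat.{u} R) M
  have h : Module.Injective R I := (Module.injective_iff_injective_object R I).2
    (inferInstanceAs (Injective (Injective.under (C := ModuleCat.{u} R) M)))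
  exact ⟨I, _, (Injective.ι (C := ModuleCat.{u} R) M).hom, _, h,
    isSES_quotient _ ((ModuleCat.mono_iff_injective _).1 inferInstance)⟩

lemma exists_factor_of_surjective {A B V : Type u} [AddCommGroup A] [Module R A] [AddCommGroup B]
    [Module R B] [AddCommGroup V] [Module R V] {g : A →ₗ[R] B} (hg : Function.Surjective g)
    (k : A →ₗ[R] V) (h : ∀ x, g x = 0 → k x = 0) : ∃ k' : B →ₗ[R] V, k' ∘ₗ g = k := by
  refine ⟨(LinearMap.ker g).liftQ k h ∘ₗ (g.quotKerEquivOfSurjective hg).symm.toLinearMap,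
    LinearMap.ext fun x => ?_⟩
  have : (g.quotKerEquivOfSurjective hg).symm (g x) = Submodule.Quotient.mk x := by
    rw [LinearEquiv.symm_apply_eq]; rfl
  exact congrArg ((LinearMap.ker g).liftQ k h) this

/-- `Ext^j(M, V) = 0`. -/
def ExtZero (j : ℕ) (M V : ModuleCat.{u} R) : Prop := Subsingleton (Ext M V j)

lemma extZero_iff {j : ℕ} {M V : ModuleCat.{u} R} : ExtZero j M V ↔ ∀ x : Ext M V j, x = 0 :=
  ⟨fun h x => h.elim x 0, fun h => ⟨fun x y => (h x).trans (h y).symm⟩⟩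

lemma ExtZero.eq_zero {j : ℕ} {M V : ModuleCat.{u} R} (h : ExtZero j M V) (x : Ext M V j) :
    x = 0 := h.elim x 0

lemma extZero_of_projective {M : ModuleCat.{u} R} (hM : Module.Projective R M)
    (V : ModuleCat.{u} R) {j : ℕ} (hj : 1 ≤ j) : ExtZero j M V := by
  have : Projective M := (IsProjective.iff_projective (R := R) (P := M)).1 hM
  exact extZero_iff.2 fun x => x.eq_zero_of_hasProjectiveDimensionLT 1 hj

lemma extZero_of_injective {V : ModuleCat.{u} R} (hV : Module.Injective R V)
    (M : ModuleCat.{u} R) {j : ℕ} (hj : 1 ≤ j) : ExtZero j M V := by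
  have : Injective V := (Module.injective_iff_injective_object R V).1 hV
  exact extZero_iff.2 fun x => x.eq_zero_of_hasInjectiveDimensionLT 1 hj

lemma ExtZero.of_retract_left {j : ℕ} {M N V : ModuleCat.{u} R} (h : ExtZero j N V)
    (i : M →ₗ[R] N) (r : N →ₗ[R] M) (hir : r ∘ₗ i = LinearMap.id) : ExtZero j M V := by
  refine extZero_iff.2 fun x => ?_
  have e : ModuleCat.ofHom i ≫ ModuleCat.ofHom r = 𝟙 M := by
    rw [← ModuleCat.ofHom_comp, hir]; rfl
  have h1 : (Ext.mk₀ (ModuleCat.ofHom i)).comp ((Ext.mk₀ (ModuleCat.ofHom r)).comp x (zero_add j))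
      (zero_add j) = x := by
    rw [Ext.mk₀_comp_mk₀_assoc, e, Ext.mk₀_id_comp]
  rw [← h1, h.eq_zero ((Ext.mk₀ (ModuleCat.ofHom r)).comp x (zero_add j)), Ext.comp_zero]

lemma ExtZero.of_equiv_left {j : ℕ} {M N V : ModuleCat.{u} R} (h : ExtZero j N V)
    (e : M ≃ₗ[R] N) : ExtZero j M V :=
  h.of_retract_left e.toLinearMap e.symm.toLinearMap (by ext; simp)

namespace IsSES

variable {A B C : ModuleCat.{u} R} {f : A →ₗ[R] B} {g : B →ₗ[R] C} (h : IsSES f g)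
include h

lemma extZero_left₂ {V : ModuleCat.{u} R} {j : ℕ} (hA : ExtZero j A V) (hC : ExtZero j C V) :
    ExtZero j B V := by
  refine extZero_iff.2 fun x => ?_
  obtain ⟨y, rfl⟩ := Ext.contravariant_sequence_exact₂ h.shortExact V x (hA.eq_zero _)
  have : y = 0 := hC.eq_zero y
  rw [this, Ext.comp_zero]

lemma extZero_left₁ {V : ModuleCat.{u} R} {j : ℕ} (hB : ExtZero j B V)
    (hC : ExtZero (j + 1) C V) : ExtZero j A V := by
  refine extZero_iff.2 fun x => ?_
  obtain ⟨y, rfl⟩ := Ext.contravariant_sequence_exact₁ h.shortExact V x (add_comm 1 j)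
    (hC.eq_zero _)
  have : y = 0 := hB.eq_zero y
  rw [this, Ext.comp_zero]

lemma extZero_left₃ {V : ModuleCat.{u} R} {j : ℕ} (hA : ExtZero j A V)
    (hB : ExtZero (j + 1) B V) : ExtZero (j + 1) C V := by
  refine extZero_iff.2 fun x => ?_
  obtain ⟨y, rfl⟩ := Ext.contravariant_sequence_exact₃ h.shortExact V x (hB.eq_zero _)
    (add_comm 1 j)
  have : y = 0 := hA.eq_zero y
  rw [this, Ext.comp_zero]

lemma extZero_right₃ {M : ModuleCat.{u} R} {j : ℕ} (hB : ExtZero j M B)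
    (hA : ExtZero (j + 1) M A) : ExtZero j M C := by
  refine extZero_iff.2 fun x => ?_
  obtain ⟨y, rfl⟩ := Ext.covariant_sequence_exact₃ M h.shortExact x rfl (hA.eq_zero _)
  have : y = 0 := hB.eq_zero y
  rw [this, Ext.zero_comp]

lemma extZero_right₁ {M : ModuleCat.{u} R} {j : ℕ} (hC : ExtZero j M C)
    (hB : ExtZero (j + 1) M B) : ExtZero (j + 1) M A := by
  refine extZero_iff.2 fun x => ?_
  obtain ⟨y, rfl⟩ := Ext.covariant_sequence_exact₁ M h.shortExact x (hB.eq_zero _) rfl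
  have : y = 0 := hC.eq_zero y
  rw [this, Ext.zero_comp]

/-- Homomorphisms `A → V` extend to `B` if `Ext¹(C, V) = 0`. -/
lemma exists_extension {V : ModuleCat.{u} R} (hC : ExtZero 1 C V) (k : A →ₗ[R] V) :
    ∃ k' : B →ₗ[R] V, k' ∘ₗ f = k := by
  obtain ⟨y, hy⟩ := Ext.contravariant_sequence_exact₁ h.shortExact V
    (Ext.mk₀ (ModuleCat.ofHom k)) (add_zero 1) (hC.eq_zero _)
  obtain ⟨k', rfl⟩ := Ext.homEquiv₀.symm.surjective y
  refine ⟨k'.hom, ?_⟩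
  rw [Ext.homEquiv₀_symm_apply, Ext.mk₀_comp_mk₀] at hy
  exact congrArg ModuleCat.Hom.hom ((Ext.mk₀_bijective _ _).1 hy)

/-- Homomorphisms `M → C` lift to `B` if `Ext¹(M, A) = 0`. -/
lemma exists_lift {M : ModuleCat.{u} R} (hA : ExtZero 1 M A) (k : M →ₗ[R] C) :
    ∃ k' : M →ₗ[R] B, g ∘ₗ k' = k := by
  obtain ⟨y, hy⟩ := Ext.covariant_sequence_exact₃ M h.shortExact
    (Ext.mk₀ (ModuleCat.ofHom k)) (zero_add 1) (hA.eq_zero _)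
  obtain ⟨k', rfl⟩ := Ext.homEquiv₀.symm.surjective y
  refine ⟨k'.hom, ?_⟩
  rw [Ext.homEquiv₀_symm_apply, Ext.mk₀_comp_mk₀] at hy
  exact congrArg ModuleCat.Hom.hom ((Ext.mk₀_bijective _ _).1 hy)

/-- If `Ext¹(B, V) = 0` and all homomorphisms `A → V` extend to `B`, then `Ext¹(C, V) = 0`. -/
lemma extZero_one_of_extension {V : ModuleCat.{u} R} (hB : ExtZero 1 B V)
    (hext : ∀ k : A →ₗ[R] V, ∃ k' : B →ₗ[R] V, k' ∘ₗ f = k) : ExtZero 1 C V := by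
  refine extZero_iff.2 fun x => ?_
  obtain ⟨y, rfl⟩ := Ext.contravariant_sequence_exact₃ h.shortExact V x (hB.eq_zero _)
    (add_zero 1)
  obtain ⟨k, rfl⟩ := Ext.homEquiv₀.symm.surjective y
  obtain ⟨k', hk'⟩ := hext k.hom
  have e : k = ModuleCat.ofHom f ≫ ModuleCat.ofHom k' := by
    ext1; exact hk'.symm
  rw [Ext.homEquiv₀_symm_apply, e, ← Ext.mk₀_comp_mk₀,
    ← Ext.comp_assoc _ _ _ (add_zero 1) (zero_add 0) (by rfl),
    h.shortExact.extClass_comp, Ext.zero_comp]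

end IsSES

lemma hasInjectiveDimensionLE_iff_extZero {V : ModuleCat.{u} R} {n : ℕ} :
    HasInjectiveDimensionLE V n ↔ ∀ M, ExtZero (n + 1) M V :=
  ⟨fun _ _ => extZero_iff.2 fun x => x.eq_zero_of_hasInjectiveDimensionLT (n + 1) le_rfl,
    fun h => hasInjectiveDimensionLT_of_enoughProjectives V (n + 1) h⟩

lemma hasProjectiveDimensionLE_iff_extZero {M : ModuleCat.{u} R} {n : ℕ} :
    HasProjectiveDimensionLE M n ↔ ∀ V, ExtZero (n + 1) M V :=
  ⟨fun _ _ => extZero_iff.2 fun x => x.eq_zero_of_hasProjectiveDimensionLT (n + 1) le_rfl,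
    fun h => hasProjectiveDimensionLT_of_enoughInjectives M (n + 1) h⟩

lemma pd_le_iff {M : ModuleCat.{u} R} {n : ℕ} : pd M ≤ n ↔ HasProjectiveDimensionLE M n := by
  rw [← projectiveDimension_le_iff, pd]
  cases projectiveDimension M with
  | bot => simp
  | coe a => exact WithBot.coe_le_coe.symm

lemma injd_le_iff {M : ModuleCat.{u} R} {n : ℕ} : injd M ≤ n ↔ HasInjectiveDimensionLE M n := by
  rw [← injectiveDimension_le_iff, injd]
  cases injectiveDimension M with
  | bot => simp
  | coe a => exact WithBot.coe_le_coe.symm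

lemma pd_le_iff_extZero {M : ModuleCat.{u} R} {n : ℕ} :
    pd M ≤ n ↔ ∀ V, ExtZero (n + 1) M V :=
  pd_le_iff.trans hasProjectiveDimensionLE_iff_extZero

lemma injd_le_iff_extZero {V : ModuleCat.{u} R} {n : ℕ} :
    injd V ≤ n ↔ ∀ M, ExtZero (n + 1) M V :=
  injd_le_iff.trans hasInjectiveDimensionLE_iff_extZero

lemma pd_le_zero_iff {M : ModuleCat.{u} R} : pd M ≤ (0 : ℕ) ↔ Module.Projective R M := by
  rw [pd_le_iff, ← projective_iff_hasProjectiveDimensionLE_zero]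
  exact (IsProjective.iff_projective (R := R) (P := M)).symm

lemma injd_le_zero_iff {M : ModuleCat.{u} R} : injd M ≤ (0 : ℕ) ↔ Module.Injective R M := by
  rw [injd_le_iff, Module.injective_iff_injective_object R M]
  exact injective_iff_hasInjectiveDimensionLT_one.symm

lemma extZero_of_pd_le {M : ModuleCat.{u} R} {n j : ℕ} (h : pd M ≤ n) (hj : n + 1 ≤ j)
    (V : ModuleCat.{u} R) : ExtZero j M V := by
  obtain ⟨k, rfl⟩ := Nat.exists_eq_add_of_le hj
  have h2 : pd M ≤ (n + k : ℕ) := h.trans (by exact_mod_cast Nat.le_add_right n k)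
  have := pd_le_iff_extZero.1 h2 V
  rwa [show n + 1 + k = n + k + 1 by omega]

lemma extZero_of_injd_le {V : ModuleCat.{u} R} {n j : ℕ} (h : injd V ≤ n) (hj : n + 1 ≤ j)
    (M : ModuleCat.{u} R) : ExtZero j M V := by
  obtain ⟨k, rfl⟩ := Nat.exists_eq_add_of_le hj
  have h2 : injd V ≤ (n + k : ℕ) := h.trans (by exact_mod_cast Nat.le_add_right n k)
  have := injd_le_iff_extZero.1 h2 M
  rwa [show n + 1 + k = n + k + 1 by omega]

end ShortExact

/-! ### Resolutions by a class of modules -/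

section Resolutions

variable {R : Type u} [Ring R] {C : ModuleCat.{u} R → Prop}

lemma HasResolution.exists_equiv_of_zero {M : ModuleCat.{u} R} (h : HasResolution C M 0) :
    ∃ G, C G ∧ Nonempty (G ≃ₗ[R] M) := by
  obtain ⟨G, d, ε, hG, hz, hs, he, -⟩ := h
  have h1 : Subsingleton (G (0 + 1)) := hz 1 one_pos
  have hinj : Function.Injective ε := by
    rw [injective_iff_map_eq_zero]
    intro x hx
    obtain ⟨y, rfl⟩ := (he x).1 hx
    rw [Subsingleton.elim y 0, map_zero]
  exact ⟨G 0, hG 0 le_rfl, ⟨LinearEquiv.ofBijective ε ⟨hinj, hs⟩⟩⟩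

lemma HasResolution.of_mem {M : ModuleCat.{u} R} (h : C M) : HasResolution C M 0 := by
  refine ⟨fun i => match i with
    | 0 => M
    | _ + 1 => ModuleCat.of R PUnit, fun _ => 0, LinearMap.id, ?_, ?_, ?_, ?_, ?_⟩
  · intro i hi
    obtain rfl := Nat.le_zero.1 hi
    exact h
  · rintro (_ | i) hi
    · exact absurd hi (lt_irrefl 0)
    · exact (inferInstance : Subsingleton PUnit)
  · exact Function.surjective_id
  · intro x
    constructor
    · intro hx
      exact ⟨0, hx.symm⟩
    · rintro ⟨y, rfl⟩
      rfl
  · intro i x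
    have : Subsingleton PUnit.{u + 1} := inferInstance
    exact ⟨fun _ => ⟨0, @Subsingleton.elim PUnit.{u + 1} _ _ _⟩, fun _ => rfl⟩

lemma HasResolution.exists_isSES {M : ModuleCat.{u} R} {n : ℕ} (h : HasResolution C M (n + 1)) :
    ∃ (K G : ModuleCat.{u} R) (f : K →ₗ[R] G) (g : G →ₗ[R] M),
      C G ∧ HasResolution C K n ∧ IsSES f g := by
  obtain ⟨G, d, ε, hG, hz, hs, he, hd⟩ := h
  refine ⟨ModuleCat.of R (LinearMap.ker ε), G 0, (LinearMap.ker ε).subtype, ε,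
    hG 0 (Nat.zero_le _), ?_, isSES_ker ε hs⟩
  refine ⟨fun i => G (i + 1), fun i => d (i + 1),
    (d 0).codRestrict (LinearMap.ker ε) fun x => he.apply_apply_eq_zero x,
    fun i hi => hG _ (Nat.succ_le_succ hi), fun i hi => hz _ (Nat.succ_lt_succ hi), ?_, ?_,
    fun i => hd (i + 1)⟩
  · rintro ⟨x, hx⟩
    obtain ⟨y, rfl⟩ := (he x).1 hx
    exact ⟨y, rfl⟩
  · intro x
    refine Iff.trans ?_ (hd 0 x)
    exact Subtype.ext_iff

lemma HasResolution.of_isSES {M K G : ModuleCat.{u} R} {n : ℕ} {f : K →ₗ[R] G} {g : G →ₗ[R] M}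
    (hG : C G) (hK : HasResolution C K n) (h : IsSES f g) : HasResolution C M (n + 1) := by
  obtain ⟨H, d, ε, hH, hz, hs, he, hd⟩ := hK
  refine ⟨fun i => match i with
    | 0 => G
    | i + 1 => H i, fun i => match i with
    | 0 => f ∘ₗ ε
    | i + 1 => d i, g, ?_, ?_, h.surjective, ?_, ?_⟩
  · rintro (_ | i) hi
    · exact hG
    · exact hH i (Nat.le_of_succ_le_succ hi)
  · rintro (_ | i) hi
    · exact absurd hi (Nat.not_lt_zero _)
    · exact hz i (Nat.lt_of_succ_lt_succ hi)
  · intro x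
    refine (h.exact x).trans ?_
    constructor
    · rintro ⟨y, rfl⟩
      obtain ⟨z, rfl⟩ := hs y
      exact ⟨z, rfl⟩
    · rintro ⟨z, rfl⟩
      exact ⟨ε z, rfl⟩
  · rintro (_ | i)
    · intro x
      refine Iff.trans ?_ (he x)
      exact (map_eq_zero_iff f h.injective)
    · exact hd i

lemma HasResolution.mono {D : ModuleCat.{u} R → Prop} (hCD : ∀ M, C M → D M)
    {M : ModuleCat.{u} R} {n : ℕ} (h : HasResolution C M n) : HasResolution D M n := by
  obtain ⟨G, d, ε, hG, h⟩ := h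
  exact ⟨G, d, ε, fun i hi => hCD _ (hG i hi), h⟩

lemma resolutionDim_le_of_hasResolution {M : ModuleCat.{u} R} {n : ℕ} (h : HasResolution C M n) :
    resolutionDim C M ≤ n :=
  sInf_le ⟨n, rfl, h⟩

lemma exists_hasResolution_of_resolutionDim_lt_top {M : ModuleCat.{u} R}
    (h : resolutionDim C M < ⊤) : ∃ n : ℕ, resolutionDim C M = n ∧ HasResolution C M n := by
  obtain ⟨k, hk, -⟩ := sInf_lt_iff.1 h
  exact csInf_mem (s := {k : ℕ∞ | ∃ n : ℕ, k = n ∧ HasResolution C M n}) ⟨k, hk⟩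

lemma resolutionDim_le_iff {M : ModuleCat.{u} R} {n : ℕ} :
    resolutionDim C M ≤ n ↔ ∃ k ≤ n, HasResolution C M k := by
  constructor
  · intro h
    obtain ⟨k, hk, hr⟩ := exists_hasResolution_of_resolutionDim_lt_top
      (h.trans_lt (ENat.natCast_lt_top n))
    rw [hk] at h
    exact ⟨k, by exact_mod_cast h, hr⟩
  · rintro ⟨k, hk, h⟩
    exact (resolutionDim_le_of_hasResolution h).trans (by exact_mod_cast hk)

end Resolutions

/-! ### Flat dimension and character modules -/

section FlatDimension

open CategoryTheory Abelian

variable {R : Type u} [Ring R]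

/-- If `Ext¹(M, B) = 0` and all homomorphisms `M → C` lift to `B`, then `Ext¹(M, A) = 0`. -/
lemma IsSES.extZero_one_of_lift {A B C : ModuleCat.{u} R} {f : A →ₗ[R] B} {g : B →ₗ[R] C}
    (h : IsSES f g) {M : ModuleCat.{u} R} (hB : ExtZero 1 M B)
    (hlift : ∀ k : M →ₗ[R] C, ∃ k' : M →ₗ[R] B, g ∘ₗ k' = k) : ExtZero 1 M A := by
  refine extZero_iff.2 fun x => ?_
  obtain ⟨y, rfl⟩ := Ext.covariant_sequence_exact₁ M h.shortExact x (hB.eq_zero _) (zero_add 1)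
  obtain ⟨k, rfl⟩ := Ext.homEquiv₀.symm.surjective y
  obtain ⟨k', hk'⟩ := hlift k.hom
  have e : k = ModuleCat.ofHom k' ≫ ModuleCat.ofHom g := by
    ext1; exact hk'.symm
  rw [Ext.homEquiv₀_symm_apply, e, ← Ext.mk₀_comp_mk₀,
    Ext.comp_assoc _ _ _ (add_zero 0) (zero_add 1) (by rfl),
    h.shortExact.comp_extClass, Ext.comp_zero]

/-- The character module of a right module, as an object of the category of left modules. -/
abbrev charModule (J : ModuleCat.{u} Rᵐᵒᵖ) : ModuleCat.{u} R := ModuleCat.of R (CharL J)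

lemma IsSES.charModule {A B C : ModuleCat.{u} Rᵐᵒᵖ} {f : A →ₗ[Rᵐᵒᵖ] B} {g : B →ₗ[Rᵐᵒᵖ] C}
    (h : IsSES f g) : IsSES (A := charModule C) (B := charModule B) (C := charModule A)
      (CharL.map g) (CharL.map f) :=
  ⟨CharL.map_injective h.surjective, CharL.map_exact h.exact, CharL.map_surjective h.injective⟩

lemma injective_charModule_of_projective {Q : ModuleCat.{u} Rᵐᵒᵖ}
    (hQ : Module.Projective Rᵐᵒᵖ Q) : Module.Injective R (charModule Q) :=
  (isFlat_op_iff Q).1 (isFlat_of_projective Q)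

lemma isFlat_iff_extZero {M : ModuleCat.{u} R} :
    IsFlat M ↔ ∀ L : ModuleCat.{u} Rᵐᵒᵖ, ExtZero 1 M (charModule L) := by
  constructor
  · intro hM L
    obtain ⟨K, Q, f, g, hQ, h⟩ := exists_isSES_projective L
    exact h.charModule.extZero_one_of_lift
      (extZero_of_injective (injective_charModule_of_projective hQ) M le_rfl)
      ((rTensor_injective_iff f).1 (hM _ _ f h.injective))
  · intro H N N' g hg
    exact (rTensor_injective_iff g).2 fun k => (isSES_quotient g hg).charModule.exists_lift (H _) k

lemma IsFlat.extZero {M : ModuleCat.{u} R} (hM : IsFlat M) (j : ℕ) (L : ModuleCat.{u} Rᵐᵒᵖ) :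
    ExtZero (j + 1) M (charModule L) := by
  induction j generalizing L with
  | zero => exact isFlat_iff_extZero.1 hM L
  | succ j ih =>
    obtain ⟨K, Q, f, g, hQ, h⟩ := exists_isSES_projective L
    exact h.charModule.extZero_right₁ (ih K)
      (extZero_of_injective (injective_charModule_of_projective hQ) M (by omega))

lemma IsFlat.of_equiv {M N : ModuleCat.{u} R} (e : M ≃ₗ[R] N) (hM : IsFlat M) : IsFlat N :=
  isFlat_iff_extZero.2 fun L => (isFlat_iff_extZero.1 hM L).of_equiv_left e.symm

/-- Dimension shifting along a resolution by modules that are `Ext`-orthogonal to `V`. -/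
lemma HasResolution.extZero {C : ModuleCat.{u} R → Prop} {V : ModuleCat.{u} R}
    (hC : ∀ G, C G → ∀ j, ExtZero (j + 1) G V) {M : ModuleCat.{u} R} {n : ℕ}
    (h : HasResolution C M n) (j : ℕ) : ExtZero (n + j + 1) M V := by
  induction n generalizing M with
  | zero =>
    obtain ⟨G, hG, ⟨e⟩⟩ := h.exists_equiv_of_zero
    rw [zero_add]
    exact (hC G hG j).of_equiv_left e.symm
  | succ n ih =>
    obtain ⟨K, G, f, g, hG, hK, hs⟩ := h.exists_isSES
    rw [show n + 1 + j + 1 = n + j + 1 + 1 by omega]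
    exact hs.extZero_left₃ (ih hK) (hC G hG (n + j + 1))

lemma extZero_of_fd_le {M : ModuleCat.{u} R} {n j : ℕ} (h : fd M ≤ n) (hj : n + 1 ≤ j)
    (L : ModuleCat.{u} Rᵐᵒᵖ) : ExtZero j M (charModule L) := by
  obtain ⟨k, hk, hM⟩ := resolutionDim_le_iff.1 h
  have := hM.extZero (V := charModule L) (fun G hG j => hG.extZero j L) (j - k - 1)
  rwa [show k + (j - k - 1) + 1 = j by omega] at this

lemma fd_le_iff_extZero {M : ModuleCat.{u} R} {n : ℕ} :
    fd M ≤ n ↔ ∀ L : ModuleCat.{u} Rᵐᵒᵖ, ExtZero (n + 1) M (charModule L) := by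
  refine ⟨fun h => extZero_of_fd_le h le_rfl, fun h => ?_⟩
  refine resolutionDim_le_iff.2 ⟨n, le_rfl, ?_⟩
  induction n generalizing M with
  | zero => exact .of_mem (isFlat_iff_extZero.2 h)
  | succ n ih =>
    obtain ⟨K, P, f, g, hP, hs⟩ := exists_isSES_projective M
    exact .of_isSES (isFlat_of_projective P)
      (ih fun L => hs.extZero_left₁ (extZero_of_projective hP _ (by omega)) (h L)) hs

lemma fd_le_of_pd_le {M : ModuleCat.{u} R} {n : ℕ} (h : pd M ≤ n) : fd M ≤ n :=
  fd_le_iff_extZero.2 fun L => pd_le_iff_extZero.1 h (charModule L)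

/-- The flat dimension of a right module is the injective dimension of its character module. -/
lemma fd_le_iff_injd_charModule_le {J : ModuleCat.{u} Rᵐᵒᵖ} {n : ℕ} :
    fd J ≤ n ↔ injd (charModule J) ≤ n := by
  constructor
  · intro h
    obtain ⟨k, hk, hJ⟩ := resolutionDim_le_iff.1 h
    refine le_trans ?_ (show ((k : ℕ) : ℕ∞) ≤ n by exact_mod_cast hk)
    clear h hk
    induction k generalizing J with
    | zero =>
      obtain ⟨G, hG, ⟨e⟩⟩ := hJ.exists_equiv_of_zero
      exact injd_le_zero_iff.2 ((isFlat_op_iff J).1 (hG.of_equiv e))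
    | succ k ih =>
      obtain ⟨K, G, f, g, hG, hK, hs⟩ := hJ.exists_isSES
      refine injd_le_iff_extZero.2 fun M => hs.charModule.extZero_right₁
        (injd_le_iff_extZero.1 (ih hK) M)
        (extZero_of_injective ((isFlat_op_iff G).1 hG) M (by omega))
  · intro h
    refine resolutionDim_le_iff.2 ⟨n, le_rfl, ?_⟩
    induction n generalizing J with
    | zero => exact .of_mem ((isFlat_op_iff J).2 (injd_le_zero_iff.1 h))
    | succ n ih =>
      obtain ⟨K, P, f, g, hP, hs⟩ := exists_isSES_projective J
      refine .of_isSES (isFlat_of_projective P) (ih (injd_le_iff_extZero.2 fun M => ?_)) hs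
      exact hs.charModule.extZero_right₃
        (extZero_of_injective (injective_charModule_of_projective hP) M (by omega))
        (injd_le_iff_extZero.1 h M)

lemma sfli_le_iff {n : ℕ∞} :
    sfli R ≤ n ↔ ∀ I : ModuleCat.{u} R, Module.Injective R I → fd I ≤ n := iSup₂_le_iff

lemma spli_le_iff {n : ℕ∞} :
    spli R ≤ n ↔ ∀ I : ModuleCat.{u} R, Module.Injective R I → pd I ≤ n := iSup₂_le_iff

lemma silp_le_iff {n : ℕ∞} :
    silp R ≤ n ↔ ∀ P : ModuleCat.{u} R, Module.Projective R P → injd P ≤ n := iSup₂_le_iff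

lemma exists_nat_of_lt_top {a : ℕ∞} (h : a < ⊤) : ∃ n : ℕ, a = n :=
  ⟨a.toNat, (ENat.natCast_toNat h.ne).symm⟩

variable (R) in
lemma sfli_le_spli : sfli R ≤ spli R := by
  rcases eq_or_ne (spli R) ⊤ with h | h
  · rw [h]; exact le_top
  obtain ⟨n, hn⟩ := exists_nat_of_lt_top h.lt_top
  rw [hn]
  exact sfli_le_iff.2 fun I hI => fd_le_of_pd_le (spli_le_iff.1 hn.le I hI)

variable (R) in
/-- The groups `Ext^j(I, CharL J)`, for `I` an injective left module and `J` an injective right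
module, compute both `sfli R` and `sfli Rᵐᵒᵖ` once these are finite: all modules embed into
injective ones, and the groups `Ext^j(I, CharL -)` and `Ext^j(-, CharL J)` vanish for large `j`. -/
lemma sfli_eq_sfli_op (h : sfli R < ⊤) (h' : sfli Rᵐᵒᵖ < ⊤) : sfli R = sfli Rᵐᵒᵖ := by
  obtain ⟨n, hn⟩ := exists_nat_of_lt_top h
  obtain ⟨m, hm⟩ := exists_nat_of_lt_top h'
  rw [hn, hm]
  apply le_antisymm
  · rw [← hn]
    refine sfli_le_iff.2 fun I hI => fd_le_iff_extZero.2 fun L => ?_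
    suffices H : ∀ (t : ℕ) (L : ModuleCat.{u} Rᵐᵒᵖ) (j : ℕ), m + 1 ≤ j → n + 1 ≤ j + t →
        ExtZero j I (charModule L) from H n L (m + 1) le_rfl (by omega)
    intro t
    induction t with
    | zero => exact fun L j _ hj => extZero_of_fd_le (sfli_le_iff.1 hn.le I hI) hj L
    | succ t ih =>
      intro L j hj hj'
      obtain ⟨J, L', f, g, hJ, hs⟩ := exists_isSES_injective L
      exact hs.charModule.extZero_right₃
        (extZero_of_injd_le (fd_le_iff_injd_charModule_le.1 (sfli_le_iff.1 hm.le J hJ)) hj I)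
        (ih L' (j + 1) (by omega) (by omega))
  · rw [← hm]
    refine sfli_le_iff.2 fun J hJ => fd_le_iff_injd_charModule_le.2
      (injd_le_iff_extZero.2 fun M => ?_)
    suffices H : ∀ (t : ℕ) (M : ModuleCat.{u} R) (j : ℕ), n + 1 ≤ j → m + 1 ≤ j + t →
        ExtZero j M (charModule J) from H m M (n + 1) le_rfl (by omega)
    intro t
    induction t with
    | zero =>
      exact fun M j _ hj =>
        extZero_of_injd_le (fd_le_iff_injd_charModule_le.1 (sfli_le_iff.1 hm.le J hJ)) hj M
    | succ t ih =>
      intro M j hj hj'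
      obtain ⟨I, M', f, g, hI, hs⟩ := exists_isSES_injective M
      exact hs.extZero_left₁ (extZero_of_fd_le (sfli_le_iff.1 hn.le I hI) hj J)
        (ih M' (j + 1) (by omega) (by omega))

end FlatDimension

/-! ### Modules orthogonal to the syzygies of a complex -/

section Orthogonal

variable {R : Type u} [Ring R]

/-- The complex `Hom_R(P, V)` is acyclic. -/
def AcyclicProjComplex.HomAcyclicAt (P : AcyclicProjComplex R) (V : ModuleCat.{u} R) : Prop :=
  ∀ i : ℤ, Function.Exact (fun f : P.X i →ₗ[R] V => f ∘ₗ P.d i)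
    (fun f : P.X (i + 1) →ₗ[R] V => f ∘ₗ P.d (i + 1))

/-- The short exact sequence `0 → im d (i + 1) → X (i + 1) → im d i → 0`. -/
lemma AcyclicProjComplex.isSES_range (P : AcyclicProjComplex R) (i : ℤ) :
    IsSES (A := ModuleCat.of R (LinearMap.range (P.d (i + 1))))
      (C := ModuleCat.of R (LinearMap.range (P.d i)))
      (LinearMap.range (P.d (i + 1))).subtype (P.d i).rangeRestrict := by
  refine ⟨Subtype.val_injective, fun x => ?_, LinearMap.surjective_rangeRestrict _⟩
  refine Iff.trans Subtype.ext_iff ((P.exact i x).trans ?_)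
  exact ⟨fun h => ⟨⟨x, h⟩, rfl⟩, by rintro ⟨⟨_, h⟩, rfl⟩; exact h⟩

lemma AcyclicProjComplex.HomAcyclicAt.extZero {P : AcyclicProjComplex R} {V : ModuleCat.{u} R}
    (hV : P.HomAcyclicAt V) (j : ℕ) (i : ℤ) :
    ExtZero (j + 1) (ModuleCat.of R (LinearMap.range (P.d i))) V := by
  induction j generalizing i with
  | zero =>
    refine (P.isSES_range i).extZero_one_of_extension
      (extZero_of_projective (P.projective (i + 1)) V le_rfl) fun k => ?_
    obtain ⟨k', hk'⟩ := (hV (i + 1) (k ∘ₗ (P.d (i + 1)).rangeRestrict)).1 (LinearMap.ext fun x =>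
      (congrArg k (Subtype.ext ((P.exact (i + 1) _).2 ⟨x, rfl⟩))).trans (map_zero k))
    refine ⟨k', LinearMap.ext ?_⟩
    rintro ⟨_, x, rfl⟩
    exact LinearMap.congr_fun hk' x
  | succ j ih =>
    exact (P.isSES_range i).extZero_left₃ (ih (i + 1))
      (extZero_of_projective (P.projective (i + 1)) V (by omega))

/-- An acyclic complex of projective modules remains acyclic under `Hom_R(-, V)` if `V` has finite
injective dimension. -/
lemma AcyclicProjComplex.homAcyclicAt_of_injd_le (P : AcyclicProjComplex R) {V : ModuleCat.{u} R}
    {n : ℕ} (hV : injd V ≤ n) : P.HomAcyclicAt V := by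
  have H : ∀ (t j : ℕ) (i : ℤ), 1 ≤ j → n + 1 ≤ j + t →
      ExtZero j (ModuleCat.of R (LinearMap.range (P.d i))) V := by
    intro t
    induction t with
    | zero => exact fun j i _ hj => extZero_of_injd_le hV hj _
    | succ t ih =>
      intro j i hj hj'
      obtain ⟨i, rfl⟩ : ∃ i', i = i' + 1 := ⟨i - 1, by ring⟩
      exact (P.isSES_range i).extZero_left₁ (extZero_of_projective (P.projective (i + 1)) V hj)
        (ih (j + 1) i (by omega) (by omega))
  intro i k
  constructor
  · intro hk
    obtain ⟨i, rfl⟩ : ∃ i', i = i' + 1 := ⟨i - 1, by ring⟩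
    obtain ⟨k₁, hk₁⟩ := exists_factor_of_surjective
      (LinearMap.surjective_rangeRestrict (P.d (i + 1))) k fun x hx => by
        obtain ⟨y, rfl⟩ := (P.exact (i + 1) x).1 (congrArg Subtype.val hx)
        exact LinearMap.congr_fun hk y
    obtain ⟨k₂, hk₂⟩ := (P.isSES_range i).exists_extension (H n 1 i le_rfl (by omega)) k₁
    refine ⟨k₂, LinearMap.ext fun x => ?_⟩
    rw [← hk₁]
    exact LinearMap.congr_fun hk₂ ((P.d (i + 1)).rangeRestrict x)
  · rintro ⟨k, rfl⟩
    exact LinearMap.ext fun x => (congrArg k ((P.exact i _).2 ⟨x, rfl⟩)).trans (map_zero k)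

variable (R) in
/-- Modules `V` such that `Hom_R(P, V)` is acyclic for all the complexes `P` that define
PGF-modules. -/
def IsPGFOrthogonal (V : ModuleCat.{u} R) : Prop :=
  ∀ P : AcyclicProjComplex R, P.TensorAcyclic → P.HomAcyclicAt V

lemma isPGFOrthogonal_of_projective {Q : ModuleCat.{u} R} (hQ : Module.Projective R Q) :
    IsPGFOrthogonal R Q := fun _ hP => hP.homAcyclic Q hQ

lemma isPGFOrthogonal_charModule {J : ModuleCat.{u} Rᵐᵒᵖ} (hJ : Module.Injective Rᵐᵒᵖ J) :
    IsPGFOrthogonal R (charModule J) := fun P hP i =>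
  (lTensor_exact_iff (P.d (i + 1)) (P.d i)).1 (hP J hJ i)

lemma IsPGFOrthogonal.extZero {V : ModuleCat.{u} R} (hV : IsPGFOrthogonal R V)
    {M : ModuleCat.{u} R} (hM : IsPGF M) (j : ℕ) : ExtZero (j + 1) M V := by
  obtain ⟨P, hP, i, ⟨e⟩⟩ := hM
  exact ((hV P hP).extZero j i).of_equiv_left e

lemma IsPGFOrthogonal.extZero_of_pgfDim_le {V : ModuleCat.{u} R} (hV : IsPGFOrthogonal R V)
    {M : ModuleCat.{u} R} {n : ℕ} (hM : pgfDim M ≤ n) : ExtZero (n + 1) M V := by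
  obtain ⟨k, hk, hM⟩ := resolutionDim_le_iff.1 hM
  have := hM.extZero (fun G hG j => hV.extZero hG j) (n - k)
  rwa [show k + (n - k) + 1 = n + 1 by omega] at this

lemma IsPGFOrthogonal.injd_le {V : ModuleCat.{u} R} (hV : IsPGFOrthogonal R V) {n : ℕ}
    (h : pgfGlDim R ≤ n) : injd V ≤ n :=
  injd_le_iff_extZero.2 fun M => hV.extZero_of_pgfDim_le (iSup_le_iff.1 h M)

lemma silp_le_of_forall_orthogonal {n : ℕ} (h : ∀ V, IsPGFOrthogonal R V → injd V ≤ n) :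
    silp R ≤ n :=
  silp_le_iff.2 fun _ hP => h _ (isPGFOrthogonal_of_projective hP)

lemma sfli_op_le_of_forall_orthogonal {n : ℕ} (h : ∀ V, IsPGFOrthogonal R V → injd V ≤ n) :
    sfli Rᵐᵒᵖ ≤ n :=
  sfli_le_iff.2 fun _ hJ => fd_le_iff_injd_charModule_le.2 (h _ (isPGFOrthogonal_charModule hJ))

/-- If all modules have finite PGF-dimension, then the injective dimensions of the orthogonal
modules are bounded: otherwise a direct sum of modules `M n` with `Ext^(n+1)(M n, V n) ≠ 0` would
have infinite PGF-dimension. -/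
lemma exists_injd_le_of_pgfDim_lt_top (h : ∀ M : ModuleCat.{u} R, pgfDim M < ⊤) :
    ∃ n : ℕ, ∀ V, IsPGFOrthogonal R V → injd V ≤ n := by
  by_contra! H
  choose V hV hinj using H
  have H2 : ∀ n, ∃ M, ¬ ExtZero (n + 1) M (V n) := fun n => by
    by_contra! h2
    exact (hinj n).not_ge (injd_le_iff_extZero.2 h2)
  choose M hM using H2
  obtain ⟨n, hn⟩ := exists_nat_of_lt_top (h (ModuleCat.of R (Π₀ n, M n)))
  refine hM n ?_
  let i : M n →ₗ[R] Π₀ k, M k := DFinsupp.lsingle (M := fun k => M k) n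
  let r : (Π₀ k, M k) →ₗ[R] M n := DFinsupp.lapply (M := fun k => M k) n
  exact ((hV n).extZero_of_pgfDim_le hn.le).of_retract_left (N := ModuleCat.of R (Π₀ k, M k))
    i r (LinearMap.ext fun x => by simp [i, r])

end Orthogonal

/-! ### Constructions with short exact sequences -/

section Constructions

variable {R : Type u} [Ring R]

/-- The pushout `E` of two monomorphisms `N → G` and `N → K`. -/
lemma exists_isSES_pushout {N G M K H : ModuleCat.{u} R} {f : N →ₗ[R] G} {g : G →ₗ[R] M}
    {k : N →ₗ[R] K} {c : K →ₗ[R] H} (h : IsSES f g) (h' : IsSES k c) :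
    ∃ (E : ModuleCat.{u} R) (f₁ : K →ₗ[R] E) (g₁ : E →ₗ[R] M) (f₂ : G →ₗ[R] E) (g₂ : E →ₗ[R] H),
      IsSES f₁ g₁ ∧ IsSES f₂ g₂ := by
  let S : Submodule R (G × K) := LinearMap.range (f.prod (-k))
  have hS : ∀ n, S.mkQ (f n, -k n) = 0 := fun n =>
    (Submodule.Quotient.mk_eq_zero S).2 ⟨n, rfl⟩
  have hS' : ∀ x, S.mkQ x = 0 → ∃ n, (f n, -k n) = x := fun x hx =>
    (Submodule.Quotient.mk_eq_zero S).1 hx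
  have hg : S ≤ LinearMap.ker (g ∘ₗ LinearMap.fst R G K) := by
    rintro _ ⟨n, rfl⟩
    exact h.exact.apply_apply_eq_zero n
  have hc : S ≤ LinearMap.ker (c ∘ₗ LinearMap.snd R G K) := by
    rintro _ ⟨n, rfl⟩
    change c (-k n) = 0
    rw [map_neg, h'.exact.apply_apply_eq_zero, neg_zero]
  refine ⟨ModuleCat.of R ((G × K) ⧸ S), S.mkQ ∘ₗ LinearMap.inr R G K, S.liftQ _ hg,
    S.mkQ ∘ₗ LinearMap.inl R G K, S.liftQ _ hc, ⟨?_, ?_, ?_⟩, ⟨?_, ?_, ?_⟩⟩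
  · refine (injective_iff_map_eq_zero _).2 fun y hy => ?_
    obtain ⟨n, hn⟩ := hS' _ hy
    have h1 : f n = 0 := congrArg Prod.fst hn
    have h2 : -k n = y := congrArg Prod.snd hn
    rw [← h2, (map_eq_zero_iff f h.injective).1 h1, map_zero, neg_zero]
  · intro e
    obtain ⟨⟨x, y⟩, rfl⟩ := S.mkQ_surjective e
    constructor
    · intro hx
      obtain ⟨n, rfl⟩ := (h.exact x).1 hx
      refine ⟨y + k n, ?_⟩
      change S.mkQ (0, y + k n) = S.mkQ (f n, y)
      rw [← sub_eq_zero, ← map_sub, ← hS (-n)]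
      simp
    · rintro ⟨y', hy'⟩
      rw [← hy']
      exact map_zero g
  · intro m
    obtain ⟨x, rfl⟩ := h.surjective m
    exact ⟨S.mkQ (x, 0), rfl⟩
  · refine (injective_iff_map_eq_zero _).2 fun x hx => ?_
    obtain ⟨n, hn⟩ := hS' _ hx
    have h1 : f n = x := congrArg Prod.fst hn
    have h2 : -k n = 0 := congrArg Prod.snd hn
    rw [← h1, (map_eq_zero_iff k h'.injective).1 (neg_eq_zero.1 h2), map_zero]
  · intro e
    obtain ⟨⟨x, y⟩, rfl⟩ := S.mkQ_surjective e
    constructor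
    · intro hy
      obtain ⟨n, rfl⟩ := (h'.exact y).1 hy
      refine ⟨x + f n, ?_⟩
      change S.mkQ (x + f n, 0) = S.mkQ (x, k n)
      rw [← sub_eq_zero, ← map_sub, ← hS n]
      simp
    · rintro ⟨x', hx'⟩
      rw [← hx']
      exact map_zero c
  · intro m
    obtain ⟨y, rfl⟩ := h'.surjective m
    exact ⟨S.mkQ (0, y), rfl⟩

/-- The short exact sequence `0 → E / K → P / K → P / E → 0` for submodules `K ≤ E ≤ P`. -/
lemma exists_isSES_of_comp {K E M P E' : ModuleCat.{u} R} {f : K →ₗ[R] E} {g : E →ₗ[R] M}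
    {k : E →ₗ[R] P} {c : P →ₗ[R] E'} (h : IsSES f g) (h' : IsSES k c) :
    ∃ (K' : ModuleCat.{u} R) (f₁ : K →ₗ[R] P) (g₁ : P →ₗ[R] K') (f₂ : M →ₗ[R] K')
      (g₂ : K' →ₗ[R] E'), IsSES f₁ g₁ ∧ IsSES f₂ g₂ := by
  have hs : IsSES _ _ := isSES_quotient (k ∘ₗ f) (h'.injective.comp h.injective)
  set q := (LinearMap.range (k ∘ₗ f)).mkQ
  obtain ⟨f₂, hf₂⟩ := exists_factor_of_surjective h.surjective (q ∘ₗ k) fun x hx => by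
    obtain ⟨y, rfl⟩ := (h.exact x).1 hx
    exact hs.exact.apply_apply_eq_zero y
  obtain ⟨g₂, hg₂⟩ := exists_factor_of_surjective hs.surjective c fun x hx => by
    obtain ⟨y, rfl⟩ := (hs.exact x).1 hx
    exact h'.exact.apply_apply_eq_zero (f y)
  replace hf₂ : ∀ x, f₂ (g x) = q (k x) := fun x => LinearMap.congr_fun hf₂ x
  replace hg₂ : ∀ x, g₂ (q x) = c x := fun x => LinearMap.congr_fun hg₂ x
  refine ⟨_, k ∘ₗ f, q, f₂, g₂, hs, ?_, ?_, ?_⟩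
  · refine (injective_iff_map_eq_zero _).2 fun m hm => ?_
    obtain ⟨x, rfl⟩ := h.surjective m
    rw [hf₂] at hm
    obtain ⟨y, hy⟩ := (hs.exact _).1 hm
    rw [← h'.injective hy, h.exact.apply_apply_eq_zero]
  · intro z
    obtain ⟨x, rfl⟩ := hs.surjective z
    rw [hg₂]
    constructor
    · intro hx
      obtain ⟨y, rfl⟩ := (h'.exact x).1 hx
      exact ⟨g y, hf₂ y⟩
    · rintro ⟨m, hm⟩
      obtain ⟨y, rfl⟩ := h.surjective m
      rw [← hg₂, ← hm, hf₂, hg₂, h'.exact.apply_apply_eq_zero]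
  · intro z
    obtain ⟨x, rfl⟩ := h'.surjective z
    exact ⟨q x, hg₂ x⟩

/-- If `0 → A → E → C → 0` splits, then a short exact sequence `0 → C → Q → C' → 0` yields
`0 → E → A ⊕ Q → C' → 0`. -/
lemma IsSES.prod_of_retraction {A E C Q C' : ModuleCat.{u} R} {f : A →ₗ[R] E} {g : E →ₗ[R] C}
    {k : C →ₗ[R] Q} {c : Q →ₗ[R] C'} (h : IsSES f g) (h' : IsSES k c) (r : E →ₗ[R] A)
    (hr : r ∘ₗ f = LinearMap.id) :
    IsSES (B := ModuleCat.of R (A × Q)) (r.prod (k ∘ₗ g)) (c ∘ₗ LinearMap.snd R A Q) := by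
  replace hr : ∀ x, r (f x) = x := fun x => LinearMap.congr_fun hr x
  refine ⟨?_, ?_, ?_⟩
  · refine (injective_iff_map_eq_zero _).2 fun x hx => ?_
    have h1 : r x = 0 := congrArg Prod.fst hx
    have h2 : k (g x) = 0 := congrArg Prod.snd hx
    obtain ⟨a, rfl⟩ := (h.exact x).1 ((map_eq_zero_iff k h'.injective).1 h2)
    rw [← hr a, h1, map_zero]
  · rintro ⟨a, q⟩
    constructor
    · intro hq
      obtain ⟨y, rfl⟩ := (h'.exact q).1 hq
      obtain ⟨x, rfl⟩ := h.surjective y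
      refine ⟨x + f (a - r x), Prod.ext ?_ ?_⟩
      · change r (x + f (a - r x)) = a
        rw [map_add, hr, add_sub_cancel]
      · change k (g (x + f (a - r x))) = k (g x)
        rw [map_add, h.exact.apply_apply_eq_zero, add_zero]
    · rintro ⟨x, hx⟩
      rw [← hx]
      exact h'.exact.apply_apply_eq_zero (g x)
  · intro z
    obtain ⟨q, rfl⟩ := h'.surjective z
    exact ⟨(0, q), rfl⟩

/-- The horseshoe lemma for the first syzygies. -/
lemma exists_isSES_horseshoe {A B C K P Q : ModuleCat.{u} R} {f : A →ₗ[R] B} {g : B →ₗ[R] C}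
    {k : K →ₗ[R] P} {c : P →ₗ[R] A} (h : IsSES f g) (h' : IsSES k c) {p : Q →ₗ[R] C}
    (hp : Function.Surjective p) (hQ : Module.Projective R Q) :
    ∃ (L : ModuleCat.{u} R) (k₁ : L →ₗ[R] ModuleCat.of R (P × Q))
      (c₁ : ModuleCat.of R (P × Q) →ₗ[R] B) (f₁ : K →ₗ[R] L)
      (g₁ : L →ₗ[R] ModuleCat.of R (LinearMap.ker p)), IsSES k₁ c₁ ∧ IsSES f₁ g₁ := by
  obtain ⟨s, hs⟩ := Module.projective_lifting_property g p h.surjective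
  replace hs : ∀ x, g (s x) = p x := fun x => LinearMap.congr_fun hs x
  let φ : P × Q →ₗ[R] B := (f ∘ₗ c).coprod s
  have hφ : ∀ x y, φ (x, y) = f (c x) + s y := fun x y => rfl
  have hgφ : ∀ x y, g (φ (x, y)) = p y := fun x y => by
    rw [hφ, map_add, h.exact.apply_apply_eq_zero, zero_add, hs]
  have hsurj : Function.Surjective φ := fun b => by
    obtain ⟨y, hy⟩ := hp (g b)
    obtain ⟨a, ha⟩ := (h.exact (b - s y)).1 (by rw [map_sub, hs, hy, sub_self])
    obtain ⟨x, rfl⟩ := h'.surjective a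
    exact ⟨(x, y), by rw [hφ, ha, sub_add_cancel]⟩
  refine ⟨ModuleCat.of R (LinearMap.ker φ), (LinearMap.ker φ).subtype, φ,
    (LinearMap.inl R P Q ∘ₗ k).codRestrict (LinearMap.ker φ) fun x => ?_,
    (LinearMap.snd R P Q ∘ₗ (LinearMap.ker φ).subtype).codRestrict (LinearMap.ker p) ?_,
    isSES_ker (B := ModuleCat.of R (P × Q)) φ hsurj, ?_, ?_, ?_⟩
  · change f (c (k x)) + s 0 = 0
    rw [h'.exact.apply_apply_eq_zero, map_zero, map_zero, add_zero]
  · rintro ⟨⟨x, y⟩, hxy⟩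
    exact (hgφ x y).symm.trans ((congrArg g hxy).trans (map_zero g))
  · intro x y hxy
    exact h'.injective (congrArg (fun z : LinearMap.ker φ => z.1.1) hxy)
  · rintro ⟨⟨x, y⟩, hxy⟩
    constructor
    · intro hy
      have hy : y = 0 := congrArg Subtype.val hy
      subst hy
      have h1 : f (c x) + s 0 = 0 := hxy
      rw [map_zero, add_zero] at h1
      obtain ⟨z, rfl⟩ := (h'.exact x).1 ((map_eq_zero_iff f h.injective).1 h1)
      exact ⟨z, rfl⟩
    · rintro ⟨z, hz⟩
      rw [← hz]
      rfl
  · rintro ⟨y, hy⟩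
    obtain ⟨a, ha⟩ := (h.exact (-s y)).1 (by rw [map_neg, hs, neg_eq_zero]; exact hy)
    obtain ⟨x, rfl⟩ := h'.surjective a
    exact ⟨⟨(x, y), by change f (c x) + s y = 0; rw [ha, neg_add_cancel]⟩, rfl⟩

end Constructions

/-! ### Approximation by modules of finite projective dimension -/

section Approximation

open CategoryTheory Abelian

variable {R : Type u} [Ring R]

/-- A class of modules `G` that have `Ext¹(G, Q) = 0` for all projective modules `Q`, and that
embed into projective modules with cokernels in the class. -/
def IsCosyzygyClosed (D : ModuleCat.{u} R → Prop) : Prop :=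
  ∀ G, D G → (∀ Q : ModuleCat.{u} R, Module.Projective R Q → ExtZero 1 G Q) ∧
    ∃ (P G' : ModuleCat.{u} R) (f : G →ₗ[R] P) (g : P →ₗ[R] G'),
      Module.Projective R P ∧ D G' ∧ IsSES f g

variable (R) in
/-- The largest class with the property `IsCosyzygyClosed`. It is closed under extensions and
contains the Gorenstein projective modules. -/
def IsCosyzygy (M : ModuleCat.{u} R) : Prop :=
  ∃ D : ModuleCat.{u} R → Prop, IsCosyzygyClosed D ∧ D M

variable (R) in
lemma isCosyzygyClosed_isCosyzygy : IsCosyzygyClosed (IsCosyzygy R) := by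
  rintro G ⟨D, hD, hG⟩
  obtain ⟨h, P, G', f, g, hP, hG', hs⟩ := hD G hG
  exact ⟨h, P, G', f, g, hP, ⟨D, hD, hG'⟩, hs⟩

lemma IsCosyzygy.of_isSES {A B C : ModuleCat.{u} R} {f : A →ₗ[R] B} {g : B →ₗ[R] C}
    (hA : IsCosyzygy R A) (hC : IsCosyzygy R C) (h : IsSES f g) : IsCosyzygy R B := by
  refine ⟨fun B => ∃ (A C : ModuleCat.{u} R) (f : A →ₗ[R] B) (g : B →ₗ[R] C),
    IsCosyzygy R A ∧ IsCosyzygy R C ∧ IsSES f g, ?_, A, C, f, g, hA, hC, h⟩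
  rintro B ⟨A, C, f, g, hA, hC, h⟩
  obtain ⟨hA₁, P, A', k, c, hP, hA', hs⟩ := isCosyzygyClosed_isCosyzygy R A hA
  obtain ⟨hC₁, Q, C', k', c', hQ, hC', hs'⟩ := isCosyzygyClosed_isCosyzygy R C hC
  refine ⟨fun T hT => h.extZero_left₂ (hA₁ T hT) (hC₁ T hT), ?_⟩
  -- The pushout `E` of `B ← A → P` is an extension of `C` by `P`, and it splits.
  obtain ⟨E, f₁, g₁, f₂, g₂, h₁, h₂⟩ := exists_isSES_pushout h hs
  obtain ⟨r, hr⟩ := h₁.exists_extension (hC₁ P hP) LinearMap.id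
  obtain ⟨B', k₁, c₁, f₃, g₃, h₃, h₄⟩ := exists_isSES_of_comp h₂ (h₁.prod_of_retraction hs' r hr)
  exact ⟨_, B', k₁, c₁, (inferInstance : Module.Projective R (P × Q)),
    ⟨A', C', f₃, g₃, hA', hC', h₄⟩, h₃⟩

lemma IsGorensteinProjective.isCosyzygy {M : ModuleCat.{u} R} (hM : IsGorensteinProjective M) :
    IsCosyzygy R M := by
  refine ⟨IsGorensteinProjective, ?_, hM⟩
  rintro M ⟨P, hP, i, ⟨e⟩⟩
  refine ⟨fun Q hQ =>
    (AcyclicProjComplex.HomAcyclicAt.extZero (hP Q hQ) 0 i).of_equiv_left e, ?_⟩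
  obtain ⟨i, rfl⟩ : ∃ i', i = i' + 1 := ⟨i - 1, by ring⟩
  exact ⟨_, ModuleCat.of R (LinearMap.range (P.d i)), _, _, P.projective (i + 1),
    ⟨P, hP, i, ⟨LinearEquiv.refl R _⟩⟩, (P.isSES_range i).comp_equiv e⟩

lemma IsSES.pd_le {A B C : ModuleCat.{u} R} {f : A →ₗ[R] B} {g : B →ₗ[R] C} (h : IsSES f g)
    (hB : Module.Projective R B) {n : ℕ} (hA : pd A ≤ n) : pd C ≤ (n + 1 : ℕ) :=
  pd_le_iff_extZero.2 fun V => h.extZero_left₃ (pd_le_iff_extZero.1 hA V)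
    (extZero_of_projective hB V (by omega))

/-- Auslander–Buchweitz approximation: a module with a resolution of length `n` by modules of the
class `IsCosyzygy` embeds into a module of projective dimension at most `n`, with cokernel in the
class. -/
lemma exists_isSES_pd_le {M : ModuleCat.{u} R} {n : ℕ} (hM : HasResolution (IsCosyzygy R) M n) :
    ∃ (K G : ModuleCat.{u} R) (f : M →ₗ[R] K) (g : K →ₗ[R] G),
      pd K ≤ n ∧ IsCosyzygy R G ∧ IsSES f g := by
  induction n generalizing M with
  | zero =>
    obtain ⟨G, hG, ⟨e⟩⟩ := hM.exists_equiv_of_zero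
    obtain ⟨-, P, G', f, g, hP, hG', hs⟩ := isCosyzygyClosed_isCosyzygy R _ hG
    exact ⟨P, G', _, g, pd_le_zero_iff.2 hP, hG', hs.comp_equiv e.symm⟩
  | succ n ih =>
    obtain ⟨N, G, f, g, hG, hN, hs⟩ := hM.exists_isSES
    obtain ⟨K, H, k, c, hK, hH, hs'⟩ := ih hN
    obtain ⟨E, f₁, g₁, f₂, g₂, h₁, h₂⟩ := exists_isSES_pushout hs hs'
    obtain ⟨-, P, E', k', c', hP, hE', h₃⟩ :=
      isCosyzygyClosed_isCosyzygy R E (hG.of_isSES hH h₂)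
    obtain ⟨K', k₄, c₄, f₅, g₅, h₄, h₅⟩ := exists_isSES_of_comp h₁ h₃
    exact ⟨K', E', f₅, g₅, h₄.pd_le hP hK, hE', h₅⟩

/-- The embedding of an injective module into a module of finite projective dimension splits. -/
lemma pd_le_of_injective {I : ModuleCat.{u} R} (hI : Module.Injective R I) {n : ℕ}
    (h : gpd I ≤ n) : pd I ≤ n := by
  obtain ⟨m, hm, hr⟩ := resolutionDim_le_iff.1 h
  obtain ⟨K, G, f, g, hK, -, hs⟩ :=
    exists_isSES_pd_le (hr.mono fun _ hG => hG.isCosyzygy)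
  obtain ⟨r, hr⟩ := hs.exists_extension (extZero_of_injective hI G le_rfl) LinearMap.id
  refine pd_le_iff_extZero.2 fun V => ?_
  exact (extZero_of_pd_le hK (Nat.succ_le_succ hm) V).of_retract_left f r hr

lemma gpd_le_pgfDim (M : ModuleCat.{u} R) : gpd M ≤ pgfDim M :=
  sInf_le_sInf fun _ ⟨n, hn, h⟩ => ⟨n, hn, h.mono fun _ hG => hG.isGorensteinProjective⟩

variable (R) in
lemma gGlDim_le_pgfGlDim : gGlDim R ≤ pgfGlDim R := iSup_mono gpd_le_pgfDim

variable (R) in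
lemma spli_le_gGlDim : spli R ≤ gGlDim R := by
  rcases eq_or_ne (gGlDim R) ⊤ with h | h
  · rw [h]; exact le_top
  obtain ⟨n, hn⟩ := exists_nat_of_lt_top h.lt_top
  rw [hn]
  exact spli_le_iff.2 fun I hI => pd_le_of_injective hI (iSup_le_iff.1 hn.le I)

/-- If all modules have finite Gorenstein projective dimension, then the projective dimensions of
injective modules are bounded, as one sees from products of injective modules. -/
lemma spli_lt_top_of_gpd_lt_top (h : ∀ M : ModuleCat.{u} R, gpd M < ⊤) : spli R < ⊤ := by
  by_contra hs
  have H : ∀ n : ℕ, ∃ I : ModuleCat.{u} R, Module.Injective R I ∧ ¬ pd I ≤ n := fun n => by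
    by_contra! hn
    exact hs ((spli_le_iff.2 hn).trans_lt (ENat.natCast_lt_top n))
  choose I hI hpd using H
  have hprod : Module.Injective R (∀ n, I n) := Module.Injective.pi R (fun n => I n)
  obtain ⟨n, hn⟩ := exists_nat_of_lt_top (h (ModuleCat.of R (∀ n, I n)))
  have hpi := pd_le_of_injective (I := ModuleCat.of R (∀ n, I n)) hprod hn.le
  refine hpd n (pd_le_iff_extZero.2 fun V => ?_)
  exact (pd_le_iff_extZero.1 hpi V).of_retract_left
    (LinearMap.single R (fun k => I k) n) (LinearMap.proj n) (LinearMap.ext fun x => by simp)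

end Approximation

/-! ### Complete resolutions -/

section CompleteResolution

variable {R : Type u} [Ring R]

/-- `K` is an `n`-th syzygy of `M`, with respect to some projective resolution of `M`. -/
inductive IsNthSyzygy : ℕ → ModuleCat.{u} R → ModuleCat.{u} R → Prop
  | zero (M : ModuleCat.{u} R) : IsNthSyzygy 0 M M
  | succ {n : ℕ} {K L P M : ModuleCat.{u} R} {f : L →ₗ[R] P} {g : P →ₗ[R] M}
      (hP : Module.Projective R P) (h : IsSES f g) (hK : IsNthSyzygy n K L) :
      IsNthSyzygy (n + 1) K M

lemma exists_isNthSyzygy (n : ℕ) (M : ModuleCat.{u} R) : ∃ K, IsNthSyzygy n K M := by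
  induction n generalizing M with
  | zero => exact ⟨M, .zero M⟩
  | succ n ih =>
    obtain ⟨L, P, f, g, hP, h⟩ := exists_isSES_projective M
    obtain ⟨K, hK⟩ := ih L
    exact ⟨K, .succ hP h hK⟩

/-- If `M` embeds into a module of projective dimension at most `n`, then its `n`-th syzygies embed
into projective modules, with cokernels that are again `n`-th syzygies. -/
lemma IsNthSyzygy.exists_isSES {n : ℕ} {K M : ModuleCat.{u} R} (hK : IsNthSyzygy n K M)
    {I M' : ModuleCat.{u} R} {f : M →ₗ[R] I} {g : I →ₗ[R] M'} (h : IsSES f g) (hI : pd I ≤ n) :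
    ∃ (P K' : ModuleCat.{u} R) (k : K →ₗ[R] P) (c : P →ₗ[R] K'),
      Module.Projective R P ∧ IsNthSyzygy n K' M' ∧ IsSES k c := by
  induction hK generalizing I M' with
  | zero M => exact ⟨I, M', f, g, pd_le_zero_iff.1 hI, .zero M', h⟩
  | @succ n K L P M k c hP hs hK ih =>
    obtain ⟨_, Q, _, p, hQ, hp⟩ := exists_isSES_projective M'
    obtain ⟨L₁, k₁, c₁, f₁, g₁, h₁, h₂⟩ := exists_isSES_horseshoe h hs hp.surjective hQ
    have hL₁ : pd L₁ ≤ n := pd_le_iff_extZero.2 fun V => h₁.extZero_left₁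
      (extZero_of_projective (inferInstance : Module.Projective R (P × Q)) V (by omega))
      (pd_le_iff_extZero.1 hI V)
    obtain ⟨P', K', k', c', hP', hK', hs'⟩ := ih h₂ hL₁
    exact ⟨P', K', k', c', hP', .succ hQ (isSES_ker p hp.surjective) hK', hs'⟩

/-- An acyclic complex of projective modules, spliced from short exact sequences
`0 → Z (i + 1) → Y i → Z i → 0`. -/
lemma exists_acyclicProjComplex_of_isSES {Z Y : ℤ → ModuleCat.{u} R}
    (hY : ∀ i, Module.Projective R (Y i)) (f : ∀ i, Z (i + 1) →ₗ[R] Y i) (g : ∀ i, Y i →ₗ[R] Z i)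
    (h : ∀ i, IsSES (f i) (g i)) (i : ℤ) :
    ∃ P : AcyclicProjComplex R, P.IsSyzygy (Z (i + 1)) := by
  refine ⟨⟨Y, fun i => f i ∘ₗ g (i + 1), hY, fun i x => ?_⟩, i,
    ⟨(LinearEquiv.ofInjective (f i) (h i).injective).trans (LinearEquiv.ofEq _ _
      (LinearMap.range_comp_of_range_eq_top _
        (LinearMap.range_eq_top.2 (h (i + 1)).surjective)).symm)⟩⟩
  refine (map_eq_zero_iff (f i) (h i).injective).trans (((h (i + 1)).exact x).trans ?_)
  constructor
  · rintro ⟨y, rfl⟩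
    obtain ⟨z, rfl⟩ := (h (i + 1 + 1)).surjective y
    exact ⟨z, rfl⟩
  · rintro ⟨z, rfl⟩
    exact ⟨_, rfl⟩

/-- If all modules of a class embed into projective modules with cokernels in the class, then they
are syzygies of acyclic complexes of projective modules. -/
lemma exists_acyclicProjComplex {D : ModuleCat.{u} R → Prop}
    (hD : ∀ G, D G → ∃ (P G' : ModuleCat.{u} R) (f : G →ₗ[R] P) (g : P →ₗ[R] G'),
      Module.Projective R P ∧ D G' ∧ IsSES f g) {M : ModuleCat.{u} R} (hM : D M) :
    ∃ P : AcyclicProjComplex R, P.IsSyzygy M := by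
  let r : ModuleCat.{u} R → ModuleCat.{u} R → Prop := fun A B =>
    ∃ (P : ModuleCat.{u} R) (f : A →ₗ[R] P) (g : P →ₗ[R] B), Module.Projective R P ∧ IsSES f g
  obtain ⟨N, hN0, hN⟩ := exists_dependent_seq (σ := fun _ => {G : ModuleCat.{u} R // D G})
    (r := fun _ A B => r A B) ⟨M, hM⟩ fun _ A => by
      obtain ⟨P, G', f, g, hP, hG', hs⟩ := hD A A.2
      exact ⟨⟨G', hG'⟩, P, f, g, hP, hs⟩
  obtain ⟨L, hL0, hL⟩ := exists_dependent_seq (σ := fun _ => ModuleCat.{u} R)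
    (r := fun _ A B => r B A) M fun _ A => by
      obtain ⟨K, P, f, g, hP, hs⟩ := exists_isSES_projective A
      exact ⟨K, P, f, g, hP, hs⟩
  let Z : ℤ → ModuleCat.{u} R := fun i => match i with
    | .ofNat k => L k
    | .negSucc k => N (k + 1)
  have hZ : ∀ i : ℤ, r (Z (i + 1)) (Z i) := fun i => match i with
    | .ofNat k => hL k
    | .negSucc 0 => by
      have h0 : r (N 0) (N 1) := hN 0
      rw [hN0] at h0
      change r (L 0) (N 1)
      rw [hL0]
      exact h0
    | .negSucc (k + 1) => hN (k + 1)
  choose Y f g hY hs using hZ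
  obtain ⟨P, hP⟩ := exists_acyclicProjComplex_of_isSES hY f g hs (-1)
  have hM' : Z (-1 + 1) = M := hL0
  rw [hM'] at hP
  exact ⟨P, hP⟩

/-- If the flat dimensions of injective right modules are finite, then tensoring with these modules
preserves acyclicity of complexes of projective modules. -/
lemma AcyclicProjComplex.tensorAcyclic_of_sfli_op_lt_top (P : AcyclicProjComplex R)
    (h : sfli Rᵐᵒᵖ < ⊤) : P.TensorAcyclic := by
  intro J hJ i
  obtain ⟨m, hm⟩ := exists_nat_of_lt_top h
  have hJ' : injd (charModule J) ≤ m :=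
    fd_le_iff_injd_charModule_le.1 (sfli_le_iff.1 hm.le J hJ)
  exact (lTensor_exact_iff (P.d (i + 1)) (P.d i)).2 (P.homAcyclicAt_of_injd_le hJ' i)

lemma isPGF_of_projective (h : sfli Rᵐᵒᵖ < ⊤) {Q : ModuleCat.{u} R}
    (hQ : Module.Projective R Q) : IsPGF Q := by
  obtain ⟨P, hP⟩ := exists_acyclicProjComplex (D := fun Q => Module.Projective R Q)
    (fun G hG => ⟨G, ModuleCat.of R PUnit, LinearMap.id, 0, hG,
      (inferInstance : Module.Projective R PUnit.{u + 1}), Function.injective_id,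
      fun x => ⟨fun _ => ⟨x, rfl⟩, fun _ => rfl⟩, fun x => ⟨0, rfl⟩⟩) hQ
  exact ⟨P, P.tensorAcyclic_of_sfli_op_lt_top h, hP⟩

lemma IsNthSyzygy.isPGF {n : ℕ} {K M : ModuleCat.{u} R} (hK : IsNthSyzygy n K M)
    (hspli : spli R ≤ n) (h : sfli Rᵐᵒᵖ < ⊤) : IsPGF K := by
  obtain ⟨P, hP⟩ := exists_acyclicProjComplex (D := fun K => ∃ M, IsNthSyzygy n K M)
    (fun K ⟨M, hK⟩ => by
      obtain ⟨I, M', f, g, hI, hs⟩ := exists_isSES_injective M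
      obtain ⟨P, K', k, c, hP, hK', hs'⟩ := hK.exists_isSES hs (spli_le_iff.1 hspli I hI)
      exact ⟨P, K', k, c, hP, ⟨M', hK'⟩, hs'⟩) ⟨M, hK⟩
  exact ⟨P, P.tensorAcyclic_of_sfli_op_lt_top h, hP⟩

lemma IsNthSyzygy.hasResolution {C : ModuleCat.{u} R → Prop}
    (hC : ∀ P : ModuleCat.{u} R, Module.Projective R P → C P) {n : ℕ} {K M : ModuleCat.{u} R}
    (h : IsNthSyzygy n K M) (hK : C K) : HasResolution C M n := by
  induction h with
  | zero M => exact .of_mem hK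
  | succ hP hs _ ih => exact .of_isSES (hC _ hP) (ih hK) hs

lemma pgfGlDim_le_spli (h : spli R < ⊤) (h' : sfli Rᵐᵒᵖ < ⊤) : pgfGlDim R ≤ spli R := by
  obtain ⟨n, hn⟩ := exists_nat_of_lt_top h
  refine iSup_le fun M => ?_
  obtain ⟨K, hK⟩ := exists_isNthSyzygy n M
  rw [hn]
  exact resolutionDim_le_of_hasResolution
    (hK.hasResolution (fun P hP => isPGF_of_projective h' hP) (hK.isPGF hn.le h'))

/-- A module of finite projective dimension `k` has `Ext^k(M, Q) ≠ 0` for some projective module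
`Q`, so `k` is at most the injective dimension of `Q`. -/
lemma pd_le_of_silp_le {M : ModuleCat.{u} R} {n m : ℕ} (hM : pd M ≤ n) (hm : silp R ≤ m) :
    pd M ≤ m := by
  suffices H : ∀ t : ℕ, pd M ≤ (m + t : ℕ) → pd M ≤ m from
    H n (hM.trans (by exact_mod_cast Nat.le_add_left n m))
  intro t
  induction t with
  | zero => exact id
  | succ t ih =>
    refine fun h => ih (pd_le_iff_extZero.2 fun V => ?_)
    obtain ⟨K, Q, f, g, hQ, hs⟩ := exists_isSES_projective V
    exact hs.extZero_right₃ (extZero_of_injd_le (silp_le_iff.1 hm Q hQ) (by omega) M)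
      (extZero_of_pd_le h (by omega) K)

lemma spli_le_silp (h : spli R < ⊤) : spli R ≤ silp R := by
  rcases eq_or_ne (silp R) ⊤ with h' | h'
  · rw [h']; exact le_top
  obtain ⟨n, hn⟩ := exists_nat_of_lt_top h
  obtain ⟨m, hm⟩ := exists_nat_of_lt_top h'.lt_top
  rw [hm]
  exact spli_le_iff.2 fun I hI => pd_le_of_silp_le (spli_le_iff.1 hn.le I hI) hm.le

variable (R) in
/-- Finite PGF global dimension bounds all the invariants of the ring. -/
lemma invariants_of_pgfGlDim_lt_top (h : pgfGlDim R < ⊤) :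
    pgfGlDim R = spli R ∧ spli R = silp R ∧ sfli R = sfli Rᵐᵒᵖ ∧ sfli Rᵐᵒᵖ < ⊤ := by
  obtain ⟨n, hn⟩ := exists_nat_of_lt_top h
  have hV : ∀ V, IsPGFOrthogonal R V → injd V ≤ n := fun V hV => hV.injd_le hn.le
  have hspli : spli R ≤ pgfGlDim R := (spli_le_gGlDim R).trans (gGlDim_le_pgfGlDim R)
  have hspli' : spli R < ⊤ := hspli.trans_lt h
  have hsfli : sfli Rᵐᵒᵖ < ⊤ :=
    (sfli_op_le_of_forall_orthogonal hV).trans_lt (ENat.natCast_lt_top n)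
  have heq : pgfGlDim R = spli R := (pgfGlDim_le_spli hspli' hsfli).antisymm hspli
  refine ⟨heq, (spli_le_silp hspli').antisymm ?_,
    sfli_eq_sfli_op R ((sfli_le_spli R).trans_lt hspli') hsfli, hsfli⟩
  rw [← heq, hn]
  exact silp_le_of_forall_orthogonal hV

end CompleteResolution

end PGF

end

theorem theorem5p1 (R : Type u) [Ring R] :
    List.TFAE
      [PGF.pgfGlDim R < ⊤,
       ∀ M : ModuleCat.{u} R, PGF.pgfDim M < ⊤,
       (PGF.spli R = PGF.silp R ∧ PGF.silp R < ⊤) ∧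
         (PGF.sfli R = PGF.sfli Rᵐᵒᵖ ∧ PGF.sfli Rᵐᵒᵖ < ⊤),
       PGF.spli R < ⊤ ∧ PGF.sfli Rᵐᵒᵖ < ⊤] ∧
    (PGF.pgfGlDim R < ⊤ →
      PGF.pgfGlDim R = PGF.spli R ∧ PGF.spli R = PGF.silp R ∧ PGF.silp R = PGF.gGlDim R) := by
  constructor
  · tfae_have 1 → 2 := fun h M => (le_iSup PGF.pgfDim M).trans_lt h
    tfae_have 2 → 4 := fun h => by
      obtain ⟨n, hn⟩ := PGF.exists_injd_le_of_pgfDim_lt_top h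
      exact ⟨PGF.spli_lt_top_of_gpd_lt_top fun M => (PGF.gpd_le_pgfDim M).trans_lt (h M),
        (PGF.sfli_op_le_of_forall_orthogonal hn).trans_lt (ENat.natCast_lt_top n)⟩
    tfae_have 4 → 1 := fun ⟨h, h'⟩ => (PGF.pgfGlDim_le_spli h h').trans_lt h
    tfae_have 1 → 3 := fun h => by
      obtain ⟨h₁, h₂, h₃, h₄⟩ := PGF.invariants_of_pgfGlDim_lt_top R h
      exact ⟨⟨h₂, by rwa [← h₂, ← h₁]⟩, h₃, h₄⟩
    tfae_have 3 → 4 := fun ⟨⟨h₁, h₂⟩, _, h₃⟩ => ⟨h₁.trans_lt h₂, h₃⟩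
    tfae_finish
  · intro h
    obtain ⟨h₁, h₂, -, -⟩ := PGF.invariants_of_pgfGlDim_lt_top R h
    refine ⟨h₁, h₂, h₂.symm.trans ((PGF.spli_le_gGlDim R).antisymm ?_)⟩
    rw [← h₁]
    exact PGF.gGlDim_le_pgfGlDim R
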